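/- Let $K$ be a field and let $E=\bigoplus_{n\in\mathbb Z}E_n$ be a $\mathbb Z$-graded $K$-vector space. **Definitions.** An $\mathcal{E}ilh$-algebra is a graded vector space with a differential $Q$ of degree $1$ and binary products $\oslash_i$ of degree $i\in\mathbb N=\{0,1,\dots\}$ such that, for homogeneous $a,b,c$ and all $i<j$, $$a\oslash_i(b\oslash_i c)=(-1)^{i(|a|+1)}\big((a\oslash_i b)\oslash_i c+(-1)^{i+|a||b|}(b\oslash_i a)\oslash_i c\big),$$ $$a\oslash_i(b\oslash_j c)=(-1)^{ij+j|a|}(a\oslash_i b)\oslash_j c,$$ $$a\oslash_j(b\oslash_i c)=(-1)^{i|a|+|a||b|}(b\oslash_i a)\oslash_j c+[j-i\ge2]\,(-1)^{i(|a|+j+1)+(|a|+|b|)|c|}(c\oslash_{j-1}a)\oslash_{i+1}b+[j-i>2]\,(-1)^{j+|a|(|b|+i)+(|a|+|b|)|c|}(c\oslash_{i+1}b)\oslash_{j-1}a,$$ where $[\,\cdot\,]$ is $1$ if the condition holds and $0$ otherwise, and $$Q(a\oslash_i b)=(-1)^i\big((Qa)\oslash_i b+(-1)^{|a|}a\oslash_i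 Qb\big)+(-1)^i\,a\oslash_{i+1}b-(-1)^{|a||b|}\,b\oslash_{i+1}a .$$ Let $C(E)$ be the space of all elements, of the space of $\mathbb N$-labelled planar binary trees with leaves decorated by $E[1]$, on which all the quadratic relations vanish. Its linear dual $\mathsf{CE}(E)=C(E)^*$ is the completed free reduced (non-unital) algebra with these products and quadratic relations on $V=E[1]^*$. An (uncurved) $EL_\infty$-algebra structure on $E$ is a continuous $Q$ on $\mathsf{CE}(E)$ of degree $1$ (that is, $Q=D^*$ for a linear map $D:C(E)\to C(E)$) with $Q^2=0$ that satisfies the above rule for $Q(a\oslash_i b)$. Equivalently, $E$ is an algebra over the cobar construction of the Koszul dual cooperad of $h\mathcal{L}ie$. Its unary product $\varepsilon_1:E\to E$ is, up to the sign conventions of the shift, dual to the linear part of $Q$; it has degree $1$ and $\varepsilon_1^2=0$. A morphism $\phi:\mathfrak E\to\mathfrak E'$ of $EL_\infty$-algebras is dual to a continuous degree-$0$ map $\Phi:\mathsf{CE}(E')\to\mathsf{CE}(E)$ with $\Phi(x\oslash_i y)=\Phi(x)\oslash_i\Phi(y)$ for all $i$ and $Q\Phi=\Phi Q'$. Its linear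 component $\phi_1:E\to E'$ is a chain map, and $\phi$ is a quasi-isomorphism if $\phi_1$ induces an isomorphism on cohomology. **Minimal model theorem.** For every $EL_\infty$-algebra $\mathfrak E$ on $E$, the cohomology $H=H^\bullet_{\varepsilon_1}(\mathfrak E)$ is a graded vector space (graded by the classes of homogeneous cocycles), and it carries an $EL_\infty$-algebra structure $\mathfrak H$ with vanishing unary product that is quasi-isomorphic to $\mathfrak E$. More precisely, there is a quasi-isomorphism $\psi:\mathfrak H\to\mathfrak E$ whose linear component maps every class to a cocycle that represents it. If $K$ has characteristic $0$, then there is also a quasi-isomorphism $\phi:\mathfrak E\to\mathfrak H$ whose linear component maps every cocycle to its class. -/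

import Mathlib

open scoped TensorProduct DirectSum

noncomputable section

namespace ELInfinity

universe u v

/-- Planar binary trees whose nodes carry a label in `ℕ`: the shapes of the iterated products built
from the binary operations `⊘_i`. -/
inductive Shape : Type
  | leaf : Shape
  | node (i : ℕ) (l r : Shape) : Shape
  deriving DecidableEq

section Trees

variable (K : Type v) [Field K] (E : Type u) [AddCommGroup E] [Module K E]

/-- The tensor power of `E` whose factors are the leaves of a tree of the given shape. -/
def TreePow : Shape → ModuleCat.{u} K
  | .leaf => ModuleCat.of K E
  | .node _ l r => ModuleCat.of K ((TreePow l) ⊗[K] (TreePow r))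

/-- All trees with leaves decorated by elements of `E`, modulo multilinearity. Its linear dual is
the completed free algebra on `E[1]^*` with binary operations `⊘_i`, `i ∈ ℕ` (no relations). -/
abbrev Trees : Type u := ⨁ s : Shape, TreePow K E s

/-- A tree power of shape `leaf` is `E`. -/
def leafEquiv : TreePow K E .leaf ≃ₗ[K] E := LinearEquiv.refl K E

/-- A tree power of shape `node i l r` is the tensor product of its two branches. -/
def nodeEquiv (i : ℕ) (l r : Shape) :
    TreePow K E (.node i l r) ≃ₗ[K] TreePow K E l ⊗[K] TreePow K E r :=
  LinearEquiv.refl K (TreePow K E l ⊗[K] TreePow K E r)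

/-- Inclusion of the trees of a fixed shape. -/
def ofShape (s : Shape) : TreePow K E s →ₗ[K] Trees K E :=
  DirectSum.lof K Shape (fun s => TreePow K E s) s

/-- The tree that consists of one leaf. -/
def leafTree : E →ₗ[K] Trees K E := ofShape K E .leaf ∘ₗ (leafEquiv K E).symm.toLinearMap

/-- The leaf component. -/
def leafPart : Trees K E →ₗ[K] E :=
  (leafEquiv K E).toLinearMap ∘ₗ DirectSum.component K Shape (fun s => TreePow K E s) .leaf

variable {K E}

/-- The pure tensor with left branch `x` and right branch `y`. -/
def graft (i : ℕ) {l r : Shape} (x : TreePow K E l) (y : TreePow K E r) :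
    TreePow K E (.node i l r) :=
  (nodeEquiv K E i l r).symm (x ⊗ₜ[K] y)

/-- The part of cochain degree `d` of a tree power. A leaf `e ∈ E_n` has cochain degree `1 - n`,
the degree in `E[1]^*` of a functional dual to `e`; a node with label `i` adds `i`. -/
def shapeGrading (ℰ : ℤ → Submodule K E) : (s : Shape) → ℤ → Submodule K (TreePow K E s)
  | .leaf, d => (ℰ (1 - d)).comap (leafEquiv K E).toLinearMap
  | .node i l r, d => Submodule.span K
      {z | ∃ (p q : ℤ) (x : TreePow K E l) (y : TreePow K E r), x ∈ shapeGrading ℰ l p ∧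
        y ∈ shapeGrading ℰ r q ∧ p + q + i = d ∧ z = graft i x y}

/-- The part of cochain degree `d` of the space of trees. -/
def treeGrading (ℰ : ℤ → Submodule K E) (d : ℤ) : Submodule K (Trees K E) :=
  ⨆ s : Shape, (shapeGrading ℰ s d).map (ofShape K E s)

/-- A linear functional has degree `d` if it vanishes on the elements of any other degree. -/
def TreeDegree (ℰ : ℤ → Submodule K E) (f : Module.Dual K (Trees K E)) (d : ℤ) : Prop :=
  ∀ d' : ℤ, d' ≠ d → ∀ x ∈ treeGrading ℰ d', f x = 0

/-- The product `f ⊘_i g` of two functionals on trees, on trees of a fixed shape: on a tree with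
root label `i` and branches `x`, `y` it is `f x * g y`, on any other tree it is `0`. -/
def shapeMul (i : ℕ) (f g : Module.Dual K (Trees K E)) : (s : Shape) → TreePow K E s →ₗ[K] K
  | .leaf => 0
  | .node j l r =>
    if j = i then
      (LinearMap.mul' K K ∘ₗ TensorProduct.map (f ∘ₗ ofShape K E l) (g ∘ₗ ofShape K E r)) ∘ₗ
        (nodeEquiv K E j l r).toLinearMap
    else 0

/-- The product `f ⊘_i g` of two functionals on trees. -/
def treeMul (i : ℕ) (f g : Module.Dual K (Trees K E)) : Module.Dual K (Trees K E) :=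
  DirectSum.toModule K Shape K (shapeMul i f g)

end Trees

section Relations

/-! The quadratic relations of an `Eilh`-algebra with products `m i = ⊘_i`, and the deformed
Leibniz rule, each as `left-hand side - right-hand side`, for elements of degrees `p`, `q`, `r`. -/

variable {M : Type*} [AddCommGroup M] (m : ℕ → M → M → M)

/-- `a ⊘_i (b ⊘_i c) = (-1)^{i(|a|+1)} ((a ⊘_i b) ⊘_i c + (-1)^{i+|a||b|} (b ⊘_i a) ⊘_i c)`. -/
def relEq (i : ℕ) (p q : ℤ) (a b c : M) : M :=
  m i a (m i b c) - (Int.negOnePow (i * (p + 1))) •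
    (m i (m i a b) c + (Int.negOnePow (i + p * q)) • m i (m i b a) c)

/-- `a ⊘_i (b ⊘_j c) = (-1)^{ij+j|a|} (a ⊘_i b) ⊘_j c`, to be imposed for `i < j`. -/
def relLt (i j : ℕ) (p : ℤ) (a b c : M) : M :=
  m i a (m j b c) - (Int.negOnePow (i * j + j * p)) • m j (m i a b) c

/-- The relation for `a ⊘_j (b ⊘_i c)`, to be imposed for `i < j`:
one term if `j - i = 1`, two terms if `j - i = 2`, three terms if `j - i > 2`. -/
def relGt (i j : ℕ) (p q r : ℤ) (a b c : M) : M :=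
  m j a (m i b c) -
    ((Int.negOnePow (i * p + p * q)) • m j (m i b a) c
      + (if i + 2 ≤ j then
          (Int.negOnePow (i * (p + j + 1) + (p + q) * r)) • m (i + 1) (m (j - 1) c a) b else 0)
      + (if i + 2 < j then
          (Int.negOnePow (j + p * (q + i) + (p + q) * r)) • m (j - 1) (m (i + 1) c b) a else 0))

/-- `Q(a ⊘_i b) = (-1)^i (Qa ⊘_i b + (-1)^{|a|} a ⊘_i Qb) + (-1)^i a ⊘_{i+1} b
- (-1)^{|a||b|} b ⊘_{i+1} a`. -/
def DeformedLeibniz (Q : M → M) (i : ℕ) (p q : ℤ) (a b : M) : Prop :=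
  Q (m i a b) =
    (Int.negOnePow i) • (m i (Q a) b + (Int.negOnePow p) • m i a (Q b))
      + (Int.negOnePow i) • m (i + 1) a b - (Int.negOnePow (p * q)) • m (i + 1) b a

end Relations

variable {K : Type v} [Field K]

section Coalgebra

variable {E : Type u} [AddCommGroup E] [Module K E] (ℰ : ℤ → Submodule K E)

/-- The two-sided ideal generated by the `Eilh`-relations between homogeneous functionals. -/
inductive RelIdeal : Module.Dual K (Trees K E) → Prop
  | eq (i : ℕ) (p q : ℤ) (a b c : Module.Dual K (Trees K E)) (r : ℤ) :
      TreeDegree ℰ a p → TreeDegree ℰ b q → TreeDegree ℰ c r →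
      RelIdeal (relEq treeMul i p q a b c)
  | lt (i j : ℕ) (p q r : ℤ) (a b c : Module.Dual K (Trees K E)) : i < j →
      TreeDegree ℰ a p → TreeDegree ℰ b q → TreeDegree ℰ c r →
      RelIdeal (relLt treeMul i j p a b c)
  | gt (i j : ℕ) (p q r : ℤ) (a b c : Module.Dual K (Trees K E)) : i < j →
      TreeDegree ℰ a p → TreeDegree ℰ b q → TreeDegree ℰ c r →
      RelIdeal (relGt treeMul i j p q r a b c)
  | add (f g : Module.Dual K (Trees K E)) : RelIdeal f → RelIdeal g → RelIdeal (f + g)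
  | smul (k : K) (f : Module.Dual K (Trees K E)) : RelIdeal f → RelIdeal (k • f)
  | mulLeft (i : ℕ) (f g : Module.Dual K (Trees K E)) : RelIdeal g → RelIdeal (treeMul i f g)
  | mulRight (i : ℕ) (f g : Module.Dual K (Trees K E)) : RelIdeal f → RelIdeal (treeMul i f g)

/-- The Chevalley-Eilenberg coalgebra: the largest space of trees on which all `Eilh`-relations
hold. It is the cofree conilpotent coalgebra over the Koszul dual cooperad of `hLie` that is
cogenerated by `E[1]`, and the predual of the Chevalley-Eilenberg algebra. -/
def CECoalg : Submodule K (Trees K E) where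
  carrier := {x | ∀ f, RelIdeal ℰ f → f x = 0}
  add_mem' hx hy f hf := by rw [map_add, hx f hf, hy f hf, add_zero]
  zero_mem' f _ := map_zero f
  smul_mem' k x hx f hf := by rw [map_smul, hx f hf, smul_zero]

/-- The Chevalley-Eilenberg algebra: the completed free (reduced) `Eilh`-algebra on `E[1]^*`,
as the linear dual of the Chevalley-Eilenberg coalgebra. -/
abbrev CE : Type (max u v) := Module.Dual K (CECoalg ℰ)

/-- The part of cochain degree `d` of the Chevalley-Eilenberg coalgebra. -/
def ceGrading (d : ℤ) : Submodule K (CECoalg ℰ) := (treeGrading ℰ d).comap (CECoalg ℰ).subtype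

/-- An element of the Chevalley-Eilenberg algebra is homogeneous of degree `d`. -/
def CEDegree (f : CE ℰ) (d : ℤ) : Prop :=
  ∀ d' : ℤ, d' ≠ d → ∀ x ∈ ceGrading ℰ d', f x = 0

/-- A linear projection of all trees onto the Chevalley-Eilenberg coalgebra. -/
def ceProj : Trees K E →ₗ[K] CECoalg ℰ :=
  ((CECoalg ℰ).subtype.exists_leftInverse_of_injective (CECoalg ℰ).ker_subtype).choose

theorem ceProj_apply (x : CECoalg ℰ) : ceProj ℰ (x : Trees K E) = x :=
  LinearMap.congr_fun ((CECoalg ℰ).subtype.exists_leftInverse_of_injective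
    (CECoalg ℰ).ker_subtype).choose_spec x

/-- The product `⊘_i` of the Chevalley-Eilenberg algebra: extend both functionals to all trees,
multiply, and restrict. By `ceMul_restrict` below the extensions do not matter. -/
def ceMul (i : ℕ) (f g : CE ℰ) : CE ℰ :=
  treeMul i (f ∘ₗ ceProj ℰ) (g ∘ₗ ceProj ℰ) ∘ₗ (CECoalg ℰ).subtype

variable {ℰ}

theorem treeMul_ofShape (i : ℕ) (f g : Module.Dual K (Trees K E)) (s : Shape)
    (x : TreePow K E s) : treeMul i f g (ofShape K E s x) = shapeMul i f g s x := by
  rw [treeMul, ofShape, DirectSum.toModule_lof]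

theorem treeMul_leafTree (i : ℕ) (f g : Module.Dual K (Trees K E)) (e : E) :
    treeMul i f g (leafTree K E e) = 0 :=
  treeMul_ofShape i f g .leaf _

theorem treeMul_graft (i j : ℕ) (f g : Module.Dual K (Trees K E)) {l r : Shape}
    (x : TreePow K E l) (y : TreePow K E r) :
    treeMul i f g (ofShape K E (.node j l r) (graft j x y)) =
      if j = i then f (ofShape K E l x) * g (ofShape K E r y) else 0 := by
  rw [treeMul_ofShape, shapeMul, graft]
  split_ifs with h
  · simp
  · rfl

/-- `x ↦ (id ⊗ g)(Δ_i x)`, on trees of a fixed shape. -/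
def shapeContractRight (i : ℕ) (g : Module.Dual K (Trees K E)) :
    (s : Shape) → TreePow K E s →ₗ[K] Trees K E
  | .leaf => 0
  | .node j l r =>
    if j = i then
      ((TensorProduct.rid K (Trees K E)).toLinearMap ∘ₗ
        TensorProduct.map (ofShape K E l) (g ∘ₗ ofShape K E r)) ∘ₗ
        (nodeEquiv K E j l r).toLinearMap
    else 0

/-- `x ↦ (f ⊗ id)(Δ_i x)`, on trees of a fixed shape. -/
def shapeContractLeft (i : ℕ) (f : Module.Dual K (Trees K E)) :
    (s : Shape) → TreePow K E s →ₗ[K] Trees K E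
  | .leaf => 0
  | .node j l r =>
    if j = i then
      ((TensorProduct.lid K (Trees K E)).toLinearMap ∘ₗ
        TensorProduct.map (f ∘ₗ ofShape K E l) (ofShape K E r)) ∘ₗ
        (nodeEquiv K E j l r).toLinearMap
    else 0

theorem exists_contractRight (i : ℕ) (g : Module.Dual K (Trees K E)) :
    ∃ R : Trees K E →ₗ[K] Trees K E, ∀ f x, f (R x) = treeMul i f g x := by
  refine ⟨DirectSum.toModule K Shape _ (shapeContractRight i g), fun f x => ?_⟩
  suffices h : f ∘ₗ DirectSum.toModule K Shape _ (shapeContractRight i g) = treeMul i f g from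
    LinearMap.congr_fun h x
  refine DirectSum.linearMap_ext K fun s => LinearMap.ext fun y => ?_
  change f (DirectSum.toModule K Shape _ (shapeContractRight i g) (ofShape K E s y)) =
    treeMul i f g (ofShape K E s y)
  rw [treeMul_ofShape, ofShape, DirectSum.toModule_lof]
  cases s with
  | leaf => simp [shapeContractRight, shapeMul]
  | node j l r =>
    simp only [shapeContractRight, shapeMul]
    split_ifs with h
    · simp only [LinearMap.comp_apply]
      generalize (nodeEquiv K E j l r).toLinearMap y = z
      induction z with
      | zero => simp
      | tmul a b => simp [mul_comm]
      | add a b ha hb => simp only [map_add, ha, hb]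
    · simp

theorem exists_contractLeft (i : ℕ) (f : Module.Dual K (Trees K E)) :
    ∃ L : Trees K E →ₗ[K] Trees K E, ∀ g x, g (L x) = treeMul i f g x := by
  refine ⟨DirectSum.toModule K Shape _ (shapeContractLeft i f), fun g x => ?_⟩
  suffices h : g ∘ₗ DirectSum.toModule K Shape _ (shapeContractLeft i f) = treeMul i f g from
    LinearMap.congr_fun h x
  refine DirectSum.linearMap_ext K fun s => LinearMap.ext fun y => ?_
  change g (DirectSum.toModule K Shape _ (shapeContractLeft i f) (ofShape K E s y)) =
    treeMul i f g (ofShape K E s y)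
  rw [treeMul_ofShape, ofShape, DirectSum.toModule_lof]
  cases s with
  | leaf => simp [shapeContractLeft, shapeMul]
  | node j l r =>
    simp only [shapeContractLeft, shapeMul]
    split_ifs with h
    · simp only [LinearMap.comp_apply]
      generalize (nodeEquiv K E j l r).toLinearMap y = z
      induction z with
      | zero => simp
      | tmul a b => simp
      | add a b ha hb => simp only [map_add, ha, hb]
    · simp

/-- The product of the Chevalley-Eilenberg algebra is the restriction of the product of functionals
on all trees. -/
theorem ceMul_restrict (i : ℕ) (f g : Module.Dual K (Trees K E)) :
    ceMul ℰ i (f ∘ₗ (CECoalg ℰ).subtype) (g ∘ₗ (CECoalg ℰ).subtype) =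
      treeMul i f g ∘ₗ (CECoalg ℰ).subtype := by
  refine LinearMap.ext fun x => ?_
  obtain ⟨R, hR⟩ := exists_contractRight i
    ((g ∘ₗ (CECoalg ℰ).subtype) ∘ₗ ceProj ℰ : Module.Dual K (Trees K E))
  obtain ⟨L, hL⟩ := exists_contractLeft i f
  have hRx : R x ∈ CECoalg ℰ := fun φ hφ => by
    rw [hR]
    exact x.2 _ (RelIdeal.mulRight i _ _ hφ)
  have hLx : L x ∈ CECoalg ℰ := fun φ hφ => by
    rw [hL]
    exact x.2 _ (RelIdeal.mulLeft i _ _ hφ)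
  have h1 := ceProj_apply ℰ ⟨R x, hRx⟩
  have h2 := ceProj_apply ℰ ⟨L x, hLx⟩
  change treeMul i ((f ∘ₗ (CECoalg ℰ).subtype) ∘ₗ ceProj ℰ)
    ((g ∘ₗ (CECoalg ℰ).subtype) ∘ₗ ceProj ℰ) (x : Trees K E) = treeMul i f g (x : Trees K E)
  rw [← hR]
  simp only [LinearMap.comp_apply, h1, Submodule.subtype_apply]
  rw [hR, ← hL]
  simp only [LinearMap.comp_apply, h2, Submodule.subtype_apply]
  rw [hL]

theorem relIdeal_leafTree (f : Module.Dual K (Trees K E)) (hf : RelIdeal ℰ f) (e : E) :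
    f (leafTree K E e) = 0 := by
  induction hf with
  | eq => simp [relEq, treeMul_leafTree]
  | lt => simp [relLt, treeMul_leafTree]
  | gt i j =>
    simp only [relGt]
    split_ifs <;> simp [treeMul_leafTree]
  | add f g _ _ hf hg => simp [hf, hg]
  | smul k f _ hf => simp [hf]
  | mulLeft => exact treeMul_leafTree _ _ _ e
  | mulRight => exact treeMul_leafTree _ _ _ e

variable (ℰ)

/-- The inclusion of the cogenerators. -/
def leafIncl : E →ₗ[K] CECoalg ℰ :=
  (leafTree K E).codRestrict (CECoalg ℰ) fun e f hf => relIdeal_leafTree f hf e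

/-- The projection onto the cogenerators. -/
def leafProj : CECoalg ℰ →ₗ[K] E := leafPart K E ∘ₗ (CECoalg ℰ).subtype

end Coalgebra

section Algebras

/-- An (uncurved) `EL_∞`-algebra on the graded vector space `(E, ℰ)`: a square-zero differential of
degree `1` on the Chevalley-Eilenberg algebra that obeys the deformed Leibniz rule. The differential
`Q f = f ∘ D` is given as the transpose of an endomorphism `D` of the Chevalley-Eilenberg coalgebra,
that is, `Q` is continuous. Equivalently, `E` is an algebra over the cobar construction of the Koszul
dual cooperad of `hLie`. -/
structure ELAlgebra {E : Type u} [AddCommGroup E] [Module K E] (ℰ : ℤ → Submodule K E) where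
  /-- The codifferential on the Chevalley-Eilenberg coalgebra. -/
  D : CECoalg ℰ →ₗ[K] CECoalg ℰ
  map_degree : ∀ d : ℤ, ∀ x ∈ ceGrading ℰ d, D x ∈ ceGrading ℰ (d - 1)
  leibniz : ∀ (i : ℕ) (p q : ℤ) (f g : CE ℰ), CEDegree ℰ f p → CEDegree ℰ g q →
    DeformedLeibniz (ceMul ℰ) (fun f => f ∘ₗ D) i p q f g
  sq_zero : D ∘ₗ D = 0

variable {E : Type u} [AddCommGroup E] [Module K E] {ℰ : ℤ → Submodule K E}
  {E' : Type u} [AddCommGroup E'] [Module K E'] {ℰ' : ℤ → Submodule K E'}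

/-- The unary product `ε₁`, as the linear part of the codifferential. (With the usual sign convention
for the shift this is `(-1)^{|e|} ε₁(e)`, which has the same kernel and the same image.) -/
def ELAlgebra.unary (A : ELAlgebra ℰ) : E →ₗ[K] E := leafProj ℰ ∘ₗ A.D ∘ₗ leafIncl ℰ

/-- The cohomology `H_{ε₁}(E)`: cocycles modulo coboundaries. -/
abbrev ELAlgebra.Cohomology (A : ELAlgebra ℰ) : Type u :=
  LinearMap.ker A.unary ⧸ (LinearMap.range A.unary).submoduleOf (LinearMap.ker A.unary)

/-- The cohomology class of a cocycle. -/
def ELAlgebra.cls (A : ELAlgebra ℰ) : LinearMap.ker A.unary →ₗ[K] A.Cohomology :=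
  Submodule.mkQ _

/-- The grading of the cohomology: the classes of the cocycles of degree `n`. -/
def ELAlgebra.cohomologyGrading (A : ELAlgebra ℰ) (n : ℤ) : Submodule K A.Cohomology :=
  ((ℰ n).submoduleOf (LinearMap.ker A.unary)).map A.cls

/-- A morphism of `EL_∞`-algebras `E → E'`. It is dual to the morphism `Φ f = f ∘ F` of differential
graded `Eilh`-algebras from the Chevalley-Eilenberg algebra of `E'` to that of `E`. -/
structure ELHom (A : ELAlgebra ℰ) (A' : ELAlgebra ℰ') where
  /-- The map between the Chevalley-Eilenberg coalgebras. -/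
  F : CECoalg ℰ →ₗ[K] CECoalg ℰ'
  map_degree : ∀ d : ℤ, ∀ x ∈ ceGrading ℰ d, F x ∈ ceGrading ℰ' d
  map_mul : ∀ (i : ℕ) (f g : CE ℰ'), ceMul ℰ' i f g ∘ₗ F = ceMul ℰ i (f ∘ₗ F) (g ∘ₗ F)
  comm : F ∘ₗ A.D = A'.D ∘ₗ F

/-- The linear component `φ₁ : E → E'` of a morphism. -/
def ELHom.linearPart {A : ELAlgebra ℰ} {A' : ELAlgebra ℰ'} (φ : ELHom A A') : E →ₗ[K] E' :=
  leafProj ℰ' ∘ₗ φ.F ∘ₗ leafIncl ℰ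

/-- A morphism is a quasi-isomorphism if its linear component descends to an isomorphism between
the cohomologies. -/
def ELHom.IsQuasiIso {A : ELAlgebra ℰ} {A' : ELAlgebra ℰ'} (φ : ELHom A A') : Prop :=
  ∃ e : A.Cohomology ≃ₗ[K] A'.Cohomology, ∀ z : LinearMap.ker A.unary,
    ∃ h : φ.linearPart z ∈ LinearMap.ker A'.unary, e (A.cls z) = A'.cls ⟨φ.linearPart z, h⟩

end Algebras

end ELInfinity

end

/-! The argument is homotopy transfer, carried out on the coalgebra side. `CECoalg` behaves like a
cofree coalgebra. Any map of generators of degree 0 together with any recursion `w` of degree 0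
gives a morphism (`coalgMap`), and any components of a fixed odd degree give a coderivation
(`oddCoder`). Conversely, such maps are determined by their component in `E`. Indeed, a tree on
which all products of functionals vanish is a leaf, and the branches of a product have fewer leaves
than the whole tree (`CoderLike.eq_zero`).

Choose a contraction `incl`, `proj`, `h` of `(E, ε₁)` onto its cohomology with all side conditions.
The morphism `psi` solves the implicit equation `leafProj_psi`, which says that it extends `incl`
and that its higher components are `-h` applied to the higher components of the codifferential
evaluated on `psi` itself. Let `rho` be the morphism with linear component `proj` and no higher
components. Then `rho ∘ psi = id`, and the transferred codifferential is `rho ∘ D ∘ psi`. The only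
real claim is that `psi` commutes with the codifferentials (`defect_eq_zero`). By induction on the
number of leaves the defect takes values in the leaves. There `proj` and `h` kill it by
construction, and `D² = 0` controls its `ε₁`, so the homotopy identity forces it to vanish. Squaring
to zero is then inherited from `D`.

In characteristic 0 an inverse direction comes from a Laplacian. Extend `h` to an odd coderivation
and let `Δ` be its anticommutator with `D`. The deformation terms in the Leibniz rule cancel, so `Δ`
is an ordinary even coderivation. It commutes with `D`, and it kills the image of `psi` because the
extension of `h` does. Its linear part is `1 - incl ∘ proj`, so up to terms with fewer leaves `Δ`
counts the leaves in the complement of the harmonic part. Positive integers are invertible, so the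
coalgebra is the direct sum of `im psi` and `im Δ` (`isCompl_psi_laplacian`). The projection along
`im Δ` is the desired morphism. It is multiplicative because `Δ` is a coderivation, and it is a
chain map because `Δ` commutes with `D`. -/

noncomputable section

namespace ELInfinity

universe u v

/-! ### Trees as a free algebra with binary operations, and their detection by products of
functionals -/

section FreeMagma

variable {K : Type v} [Field K] {E : Type u} [AddCommGroup E] [Module K E]

/-- Grafting of two trees onto a root with label `i`. -/
def graftMap (i : ℕ) : Trees K E →ₗ[K] Trees K E →ₗ[K] Trees K E :=
  DirectSum.toModule K Shape _ fun l => LinearMap.flip <|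
    DirectSum.toModule K Shape _ fun r => LinearMap.flip <|
      (TensorProduct.mk K (TreePow K E l) (TreePow K E r)).compr₂
        (ofShape K E (.node i l r) ∘ₗ (nodeEquiv K E i l r).symm.toLinearMap)

theorem graftMap_ofShape (i : ℕ) {l r : Shape} (x : TreePow K E l) (y : TreePow K E r) :
    graftMap i (ofShape K E l x) (ofShape K E r y) = ofShape K E (.node i l r) (graft i x y) := by
  rw [graftMap]
  erw [DirectSum.toModule_lof]
  rw [LinearMap.flip_apply]
  erw [DirectSum.toModule_lof]
  rfl

/-- A subspace that contains all leaves and is closed under grafting contains all trees. -/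
theorem tree_induction (S : Submodule K (Trees K E)) (hleaf : ∀ e, leafTree K E e ∈ S)
    (hgraft : ∀ i x y, x ∈ S → y ∈ S → graftMap i x y ∈ S) (x : Trees K E) : x ∈ S := by
  have key : ∀ (s : Shape) (z : TreePow K E s), ofShape K E s z ∈ S := by
    intro s
    induction s with
    | leaf => exact fun z => hleaf (leafEquiv K E z)
    | node i l r hl hr =>
      intro z
      obtain ⟨w, rfl⟩ := (nodeEquiv K E i l r).symm.surjective z
      induction w with
      | zero => simp
      | tmul a b =>
        change ofShape K E _ (graft i a b) ∈ S
        rw [← graftMap_ofShape]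
        exact hgraft _ _ _ (hl a) (hr b)
      | add a b ha hb => rw [map_add, map_add]; exact S.add_mem ha hb
  induction x using DirectSum.induction_on with
  | zero => exact S.zero_mem
  | of s z => exact key s z
  | add a b ha hb => exact S.add_mem ha hb

variable {M : Type*} [AddCommGroup M] [Module K M]

theorem tree_ext {f g : Trees K E →ₗ[K] M} (hleaf : ∀ e, f (leafTree K E e) = g (leafTree K E e))
    (hgraft : ∀ i x y, f x = g x → f y = g y → f (graftMap i x y) = g (graftMap i x y)) :
    f = g :=
  LinearMap.ext (tree_induction (LinearMap.eqLocus f g) hleaf hgraft)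

/-- The extension of a linear map to trees of a fixed shape, see `treeRec`. -/
def shapeRec (a : E →ₗ[K] M) (m : ℕ → M →ₗ[K] M →ₗ[K] M) : (s : Shape) → TreePow K E s →ₗ[K] M
  | .leaf => a ∘ₗ (leafEquiv K E).toLinearMap
  | .node i l r => TensorProduct.lift ((m i).compl₁₂ (shapeRec a m l) (shapeRec a m r)) ∘ₗ
      (nodeEquiv K E i l r).toLinearMap

/-- The universal property of the space of trees: it is the free space with bilinear operations
indexed by `ℕ`. -/
def treeRec (a : E →ₗ[K] M) (m : ℕ → M →ₗ[K] M →ₗ[K] M) : Trees K E →ₗ[K] M :=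
  DirectSum.toModule K Shape M (shapeRec a m)

theorem treeRec_ofShape (a : E →ₗ[K] M) (m : ℕ → M →ₗ[K] M →ₗ[K] M) (s : Shape)
    (x : TreePow K E s) : treeRec a m (ofShape K E s x) = shapeRec a m s x := by
  rw [treeRec, ofShape, DirectSum.toModule_lof]

@[simp]
theorem treeRec_leafTree (a : E →ₗ[K] M) (m : ℕ → M →ₗ[K] M →ₗ[K] M) (e : E) :
    treeRec a m (leafTree K E e) = a e :=
  treeRec_ofShape a m .leaf _

/-- Bilinear identities may be checked on trees of fixed shapes. -/
theorem tree_ext₂ {f g : Trees K E →ₗ[K] Trees K E →ₗ[K] M}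
    (h : ∀ l r (x : TreePow K E l) (y : TreePow K E r),
      f (ofShape K E l x) (ofShape K E r y) = g (ofShape K E l x) (ofShape K E r y)) :
    f = g :=
  DirectSum.linearMap_ext K fun l => LinearMap.ext fun x =>
    DirectSum.linearMap_ext K fun r => LinearMap.ext fun y => h l r x y

@[simp]
theorem treeRec_graftMap (a : E →ₗ[K] M) (m : ℕ → M →ₗ[K] M →ₗ[K] M) (i : ℕ) (x y : Trees K E) :
    treeRec a m (graftMap i x y) = m i (treeRec a m x) (treeRec a m y) := by
  have : (graftMap i).compr₂ (treeRec a m) = (m i).compl₁₂ (treeRec a m) (treeRec a m) := by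
    refine tree_ext₂ fun l r x y => ?_
    simp only [LinearMap.compr₂_apply, LinearMap.compl₁₂_apply, graftMap_ofShape, treeRec_ofShape]
    simp [shapeRec, graft]
  exact LinearMap.congr_fun (LinearMap.congr_fun this x) y

@[simp]
theorem treeMul_graftMap (i j : ℕ) (f g : Module.Dual K (Trees K E)) (x y : Trees K E) :
    treeMul i f g (graftMap j x y) = if j = i then f x * g y else 0 := by
  have : (graftMap j).compr₂ (treeMul i f g) =
      if j = i then (LinearMap.mul K K).compl₁₂ f g else 0 := by
    refine tree_ext₂ fun l r x y => ?_
    simp only [LinearMap.compr₂_apply, graftMap_ofShape, treeMul_graft]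
    split_ifs <;> simp
  have h := LinearMap.congr_fun (LinearMap.congr_fun this x) y
  split_ifs with hij <;> simpa [hij] using h

attribute [simp] treeMul_leafTree

theorem component_ofShape_self (s : Shape) (x : TreePow K E s) :
    DirectSum.component K Shape (fun s => TreePow K E s) s (ofShape K E s x) = x :=
  DirectSum.component.lof_self ..

theorem component_ofShape_ne {s t : Shape} (h : s ≠ t) (x : TreePow K E s) :
    DirectSum.component K Shape (fun s => TreePow K E s) t (ofShape K E s x) = 0 := by
  rw [ofShape, DirectSum.component.of, dif_neg h]

@[simp]
theorem leafPart_leafTree (e : E) : leafPart K E (leafTree K E e) = e := by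
  simp [leafPart, leafTree, ofShape, DirectSum.component.lof_self]

@[simp]
theorem leafPart_graftMap (i : ℕ) (x y : Trees K E) : leafPart K E (graftMap i x y) = 0 := by
  have : (graftMap i).compr₂ (leafPart K E) = 0 := by
    refine tree_ext₂ fun l r x y => ?_
    rw [LinearMap.compr₂_apply, graftMap_ofShape]
    simp [leafPart, component_ofShape_ne]
  exact LinearMap.congr_fun (LinearMap.congr_fun this x) y

/-- Products of functionals detect everything but the leaves. -/
theorem eq_leafTree_of_treeMul_eq_zero {x : Trees K E}
    (h : ∀ i f g, treeMul i f g x = 0) : x = leafTree K E (leafPart K E x) := by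
  suffices hs : ∀ s, DirectSum.component K Shape (fun s => TreePow K E s) s x =
      DirectSum.component K Shape (fun s => TreePow K E s) s (leafTree K E (leafPart K E x)) from
    DirectSum.ext_component K hs
  rintro (_ | ⟨i, l, r⟩)
  · have := leafPart_leafTree (K := K) (leafPart K E x)
    exact ((leafEquiv K E).injective this).symm
  · have h0 : DirectSum.component K Shape (fun s => TreePow K E s) (.node i l r)
        (leafTree K E (leafPart K E x)) = 0 := by
      exact component_ofShape_ne (by simp) _
    rw [h0]
    apply (nodeEquiv K E i l r).injective
    rw [map_zero]
    -- The coordinates of a component in a tensor product basis are values of products of two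
    -- functionals, namely of coordinate functionals on the two branches.
    apply ((Module.Basis.ofVectorSpace K (TreePow K E l)).tensorProduct
      (Module.Basis.ofVectorSpace K (TreePow K E r))).ext_elem
    rintro ⟨a, b⟩
    have key : ∀ z : Trees K E,
        ((Module.Basis.ofVectorSpace K (TreePow K E l)).tensorProduct
          (Module.Basis.ofVectorSpace K (TreePow K E r))).repr (nodeEquiv K E i l r
            (DirectSum.component K Shape (fun s => TreePow K E s) (.node i l r) z)) (a, b) =
        treeMul i ((Module.Basis.ofVectorSpace K (TreePow K E l)).coord a ∘ₗ
            DirectSum.component K Shape (fun s => TreePow K E s) l)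
          ((Module.Basis.ofVectorSpace K (TreePow K E r)).coord b ∘ₗ
            DirectSum.component K Shape (fun s => TreePow K E s) r) z := by
      intro z
      induction z using DirectSum.induction_on with
      | zero => simp
      | add z w hz hw => simp only [map_add, Finsupp.add_apply, hz, hw]
      | of s z =>
        change ((Module.Basis.ofVectorSpace K (TreePow K E l)).tensorProduct
          (Module.Basis.ofVectorSpace K (TreePow K E r))).repr (nodeEquiv K E i l r
            (DirectSum.component K Shape (fun s => TreePow K E s) (.node i l r)
              (ofShape K E s z))) (a, b) = treeMul i _ _ (ofShape K E s z)
        rcases s with _ | ⟨j, l', r'⟩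
        · rw [component_ofShape_ne (by simp), map_zero, map_zero]
          exact (treeMul_leafTree ..).symm
        · obtain ⟨w, rfl⟩ := (nodeEquiv K E j l' r').symm.surjective z
          induction w with
          | zero => simp
          | add z w hz hw => simp only [map_add, Finsupp.add_apply, hz, hw]
          | tmul x y =>
            change _ = treeMul i _ _ (ofShape K E _ (graft j x y))
            rw [treeMul_graft]
            by_cases hs : Shape.node j l' r' = .node i l r
            · obtain ⟨rfl, rfl, rfl⟩ := Shape.node.inj hs
              rw [component_ofShape_self]
              simp [component_ofShape_self, mul_comm]
            · rw [component_ofShape_ne hs, map_zero, map_zero, Finsupp.zero_apply]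
              split_ifs with hj
              · by_cases hl : l' = l
                · have hr : r' ≠ r := fun hr => hs (by rw [hj, hl, hr])
                  simp [component_ofShape_ne hr]
                · simp [component_ofShape_ne hl]
              · rfl
    rw [key, h, map_zero, Finsupp.zero_apply]

end FreeMagma

/-! ### The grading by cochain degree -/

section Grading

variable {K : Type v} [Field K] {E : Type u} [AddCommGroup E] [Module K E] {ℰ : ℤ → Submodule K E}

theorem ofShape_mem_treeGrading {s : Shape} {d : ℤ} {x : TreePow K E s}
    (hx : x ∈ shapeGrading ℰ s d) : ofShape K E s x ∈ treeGrading ℰ d :=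
  Submodule.mem_iSup_of_mem s (Submodule.mem_map_of_mem hx)

theorem leafTree_mem_treeGrading {n : ℤ} {e : E} (he : e ∈ ℰ n) :
    leafTree K E e ∈ treeGrading ℰ (1 - n) := by
  refine ofShape_mem_treeGrading (s := .leaf) ?_
  change e ∈ ℰ (1 - (1 - n))
  rwa [sub_sub_cancel]

/-- Induction over the homogeneous trees. -/
theorem treeGrading_induction (S : ℤ → Submodule K (Trees K E))
    (hleaf : ∀ n, ∀ e ∈ ℰ n, leafTree K E e ∈ S (1 - n))
    (hgraft : ∀ (j : ℕ) (a b : ℤ), ∀ x ∈ treeGrading ℰ a, ∀ y ∈ treeGrading ℰ b, x ∈ S a → y ∈ S b →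
      graftMap j x y ∈ S (a + b + j)) (d : ℤ) : treeGrading ℰ d ≤ S d := by
  refine iSup_le fun s => ?_
  rw [Submodule.map_le_iff_le_comap]
  induction s generalizing d with
  | leaf =>
    intro z hz
    rw [shapeGrading, Submodule.mem_comap] at hz
    have := hleaf _ _ hz
    rwa [sub_sub_cancel] at this
  | node i l r hl hr =>
    rw [shapeGrading, Submodule.span_le]
    rintro _ ⟨p, q, x, y, hx, hy, rfl, rfl⟩
    change ofShape K E _ (graft i x y) ∈ S (p + q + i)
    rw [← graftMap_ofShape]
    exact hgraft i p q (ofShape K E l x) (ofShape_mem_treeGrading hx) (ofShape K E r y)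
      (ofShape_mem_treeGrading hy) (hl p hx) (hr q hy)

theorem graftMap_mem_treeGrading {j : ℕ} {a b : ℤ} {x y : Trees K E}
    (hx : x ∈ treeGrading ℰ a) (hy : y ∈ treeGrading ℰ b) :
    graftMap j x y ∈ treeGrading ℰ (a + b + j) := by
  suffices h : treeGrading ℰ a ≤
      ⨅ y : (treeGrading ℰ b : Submodule K (Trees K E)),
        (treeGrading ℰ (a + b + j)).comap ((graftMap j).flip (y : Trees K E)) from (Submodule.mem_iInf _).1 (h hx) ⟨y, hy⟩
  refine iSup_le fun s => ?_
  rintro _ ⟨x, hx, rfl⟩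
  refine (Submodule.mem_iInf _).2 ?_
  rintro ⟨y, hy⟩
  suffices h : treeGrading ℰ b ≤ (treeGrading ℰ (a + b + j)).comap (graftMap j (ofShape K E s x))
      from h hy
  refine iSup_le fun t => ?_
  rintro _ ⟨y, hy, rfl⟩
  rw [Submodule.mem_comap, graftMap_ofShape]
  refine ofShape_mem_treeGrading ?_
  rw [shapeGrading]
  exact Submodule.subset_span ⟨a, b, x, y, hx, hy, rfl, rfl⟩

theorem TreeDegree.treeMul {f g : Module.Dual K (Trees K E)} {p q : ℤ} (hf : TreeDegree ℰ f p)
    (hg : TreeDegree ℰ g q) (i : ℕ) : TreeDegree ℰ (treeMul i f g) (p + q + i) := by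
  intro d hd x hx
  -- Nothing is claimed in the degree `p + q + i`, so the family of subspaces is everything there
  -- and the kernel elsewhere.
  have := treeGrading_induction (ℰ := ℰ)
    (fun d => if d = p + q + i then ⊤ else LinearMap.ker (ELInfinity.treeMul i f g)) ?_ ?_ d hx
  · simpa [hd] using this
  · intro n e _
    split_ifs <;> simp
  · intro j a b x hx y hy _ _
    split_ifs with h
    · trivial
    · rw [LinearMap.mem_ker, treeMul_graftMap]
      split_ifs with hj
      · subst hj
        by_cases ha : a = p
        · have hb : b ≠ q := fun hb => h (by rw [ha, hb])
          rw [hg b hb y hy, mul_zero]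
        · rw [hf a ha x hx, zero_mul]
      · rfl

theorem TreeDegree.add {f g : Module.Dual K (Trees K E)} {p : ℤ} (hf : TreeDegree ℰ f p)
    (hg : TreeDegree ℰ g p) : TreeDegree ℰ (f + g) p := fun d hd x hx => by
  rw [LinearMap.add_apply, hf d hd x hx, hg d hd x hx, add_zero]

theorem TreeDegree.sub {f g : Module.Dual K (Trees K E)} {p : ℤ} (hf : TreeDegree ℰ f p)
    (hg : TreeDegree ℰ g p) : TreeDegree ℰ (f - g) p := fun d hd x hx => by
  rw [LinearMap.sub_apply, hf d hd x hx, hg d hd x hx, sub_zero]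

theorem TreeDegree.smul {f : Module.Dual K (Trees K E)} {p : ℤ} (hf : TreeDegree ℰ f p)
    (s : ℤˣ) : TreeDegree ℰ (s • f) p := fun d hd x hx => by
  rw [LinearMap.smul_apply, hf d hd x hx, smul_zero]

theorem TreeDegree.zero {p : ℤ} : TreeDegree ℰ (0 : Module.Dual K (Trees K E)) p :=
  fun _ _ _ _ => rfl

theorem TreeDegree.relEq {a b c : Module.Dual K (Trees K E)} {p q r : ℤ} (ha : TreeDegree ℰ a p)
    (hb : TreeDegree ℰ b q) (hc : TreeDegree ℰ c r) (i : ℕ) :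
    TreeDegree ℰ (relEq ELInfinity.treeMul i p q a b c) (p + q + r + i + i) := by
  refine .sub ?_ (.smul (.add ?_ (.smul ?_ _)) _)
  · convert ha.treeMul (hb.treeMul hc i) i using 1; ring
  · convert (ha.treeMul hb i).treeMul hc i using 1; ring
  · convert (hb.treeMul ha i).treeMul hc i using 1; ring

theorem TreeDegree.relLt {a b c : Module.Dual K (Trees K E)} {p q r : ℤ} (ha : TreeDegree ℰ a p)
    (hb : TreeDegree ℰ b q) (hc : TreeDegree ℰ c r) (i j : ℕ) :
    TreeDegree ℰ (relLt ELInfinity.treeMul i j p a b c) (p + q + r + i + j) := by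
  refine .sub ?_ (.smul ?_ _)
  · convert ha.treeMul (hb.treeMul hc j) i using 1; ring
  · convert (ha.treeMul hb i).treeMul hc j using 1; ring

theorem TreeDegree.relGt {a b c : Module.Dual K (Trees K E)} {p q r : ℤ} (ha : TreeDegree ℰ a p)
    (hb : TreeDegree ℰ b q) (hc : TreeDegree ℰ c r) {i j : ℕ} (hij : i < j) :
    TreeDegree ℰ (relGt ELInfinity.treeMul i j p q r a b c) (p + q + r + i + j) := by
  have hj : ((j - 1 : ℕ) : ℤ) = j - 1 := by omega
  refine .sub ?_ (.add (.add (.smul ?_ _) ?_) ?_)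
  · convert ha.treeMul (hb.treeMul hc i) j using 1; ring
  · convert (hb.treeMul ha i).treeMul hc j using 1; ring
  · split_ifs
    · refine .smul ?_ _
      convert (hc.treeMul ha (j - 1)).treeMul hb (i + 1) using 1; push_cast [hj]; ring
    · exact .zero
  · split_ifs
    · refine .smul ?_ _
      convert (hc.treeMul hb (i + 1)).treeMul ha (j - 1) using 1; push_cast [hj]; ring
    · exact .zero

/-- Grafting of finite families of homogeneous trees. -/
def convGraft (j : ℕ) : (ℤ →₀ Trees K E) →ₗ[K] (ℤ →₀ Trees K E) →ₗ[K] (ℤ →₀ Trees K E) :=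
  Finsupp.lsum K fun p => LinearMap.flip <| Finsupp.lsum K fun q => LinearMap.flip <|
    (graftMap j).compr₂ (Finsupp.lsingle (p + q + j))

theorem convGraft_single (j : ℕ) (p q : ℤ) (x y : Trees K E) :
    convGraft j (Finsupp.single p x) (Finsupp.single q y) =
      Finsupp.single (p + q + j) (graftMap j x y) := by
  simp [convGraft]

/-! ### Homogeneous parts, and the Chevalley-Eilenberg coalgebra as a graded subspace -/

section Decomposition

variable (ℰ) [DirectSum.Decomposition ℰ]

/-- The decomposition of a tree into its homogeneous parts. -/
def treeDecomp : Trees K E →ₗ[K] (ℤ →₀ Trees K E) :=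
  treeRec (DirectSum.toModule K ℤ _
    (fun n => Finsupp.lsingle (1 - n) ∘ₗ leafTree K E ∘ₗ (ℰ n).subtype) ∘ₗ
      (DirectSum.decomposeLinearEquiv ℰ).toLinearMap) convGraft

/-- The part of degree `d` of a tree. -/
def treePart (d : ℤ) : Trees K E →ₗ[K] Trees K E := Finsupp.lapply d ∘ₗ treeDecomp ℰ

variable {ℰ}

theorem treeDecomp_leafTree {n : ℤ} {e : E} (he : e ∈ ℰ n) :
    treeDecomp ℰ (leafTree K E e) = Finsupp.single (1 - n) (leafTree K E e) := by
  rw [treeDecomp, treeRec_leafTree, LinearMap.comp_apply, LinearEquiv.coe_coe,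
    DirectSum.decomposeLinearEquiv_apply, DirectSum.decompose_of_mem ℰ he]
  erw [DirectSum.toModule_lof]
  rfl

theorem treeDecomp_of_mem {d : ℤ} {x : Trees K E} (hx : x ∈ treeGrading ℰ d) :
    treeDecomp ℰ x = Finsupp.single d x := by
  have := treeGrading_induction (ℰ := ℰ)
    (fun d => LinearMap.eqLocus (treeDecomp ℰ) (Finsupp.lsingle d)) ?_ ?_ d hx
  · exact this
  · exact fun n e he => treeDecomp_leafTree he
  · intro j a b x _ y _ hx hy
    change treeDecomp ℰ x = Finsupp.single a x at hx
    change treeDecomp ℰ y = Finsupp.single b y at hy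
    change treeDecomp ℰ _ = Finsupp.single _ _
    rw [← convGraft_single, ← hx, ← hy, treeDecomp, treeRec_graftMap]

theorem treePart_of_mem {d : ℤ} {x : Trees K E} (hx : x ∈ treeGrading ℰ d) :
    treePart ℰ d x = x := by
  simp [treePart, treeDecomp_of_mem hx]

theorem treePart_of_mem_ne {d d' : ℤ} (h : d ≠ d') {x : Trees K E} (hx : x ∈ treeGrading ℰ d) :
    treePart ℰ d' x = 0 := by
  simp [treePart, treeDecomp_of_mem hx, h]

/-- The homogeneous trees span. -/
theorem iSup_treeGrading : ⨆ d, treeGrading ℰ d = ⊤ := by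
  rw [eq_top_iff]
  intro x _
  refine tree_induction _ (fun e => ?_) (fun i x y hx hy => ?_) x
  · induction e using DirectSum.Decomposition.inductionOn ℰ with
    | zero => rw [map_zero]; exact zero_mem _
    | add a b ha hb => rw [map_add]; exact add_mem ha hb
    | homogeneous e =>
      exact Submodule.mem_iSup_of_mem _ (leafTree_mem_treeGrading e.2)
  · induction hx using Submodule.iSup_induction' with
    | zero => simp
    | add a b _ _ ha hb => rw [map_add, LinearMap.add_apply]; exact add_mem ha hb
    | mem p x hx =>
      induction hy using Submodule.iSup_induction' with
      | zero => simp
      | add a b _ _ ha hb => rw [map_add]; exact add_mem ha hb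
      | mem q y hy => exact Submodule.mem_iSup_of_mem _ (graftMap_mem_treeGrading hx hy)

theorem hom_induction (S : Submodule K (Trees K E)) (h : ∀ d, treeGrading ℰ d ≤ S)
    (x : Trees K E) : x ∈ S :=
  (iSup_le h) (iSup_treeGrading (ℰ := ℰ) ▸ Submodule.mem_top)

variable {M : Type*} [AddCommGroup M] [Module K M]

/-- Linear maps that agree on homogeneous trees are equal. -/
theorem hom_ext {f g : Trees K E →ₗ[K] M} (h : ∀ d, ∀ x ∈ treeGrading ℰ d, f x = g x) : f = g :=
  LinearMap.ext (hom_induction (LinearMap.eqLocus f g) h)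

/-- Linear maps that agree on leaves and on graftings of homogeneous trees are equal. -/
theorem hom_graft_ext {f g : Trees K E →ₗ[K] M}
    (hleaf : ∀ n, ∀ e ∈ ℰ n, f (leafTree K E e) = g (leafTree K E e))
    (hgraft : ∀ (j : ℕ) (a b : ℤ), ∀ x ∈ treeGrading ℰ a, ∀ y ∈ treeGrading ℰ b, f x = g x →
      f y = g y → f (graftMap j x y) = g (graftMap j x y)) : f = g :=
  hom_ext (ℰ := ℰ) (treeGrading_induction (fun _ => LinearMap.eqLocus f g) hleaf hgraft)

theorem treePart_mem (d : ℤ) (x : Trees K E) : treePart ℰ d x ∈ treeGrading ℰ d := by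
  refine hom_induction (ℰ := ℰ) ((treeGrading ℰ d).comap (treePart ℰ d)) (fun d' x hx => ?_) x
  rw [Submodule.mem_comap]
  by_cases h : d' = d
  · subst h
    rwa [treePart_of_mem hx]
  · rw [treePart_of_mem_ne h hx]
    exact zero_mem _

theorem lsum_treeDecomp :
    (Finsupp.lsum K fun _ : ℤ => LinearMap.id) ∘ₗ treeDecomp ℰ = LinearMap.id :=
  hom_ext (ℰ := ℰ) fun d x hx => by simp [treeDecomp_of_mem hx]

theorem sum_treePart (x : Trees K E) : ∑ d ∈ (treeDecomp ℰ x).support, treePart ℰ d x = x :=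
  LinearMap.congr_fun (lsum_treeDecomp (ℰ := ℰ)) x

/-- A subspace that contains the homogeneous parts of a tree contains the tree. -/
theorem mem_of_treePart_mem {S : Submodule K (Trees K E)} {x : Trees K E}
    (h : ∀ d, treePart ℰ d x ∈ S) : x ∈ S := by
  rw [← sum_treePart (ℰ := ℰ) x]
  exact S.sum_mem fun d _ => h d

theorem treeDegree_comp_treePart (f : Module.Dual K (Trees K E)) (d : ℤ) :
    TreeDegree ℰ (f ∘ₗ treePart ℰ d) d := fun d' hd x hx => by
  rw [LinearMap.comp_apply, treePart_of_mem_ne hd hx, map_zero]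

theorem TreeDegree.comp_treePart {f : Module.Dual K (Trees K E)} {p : ℤ} (hf : TreeDegree ℰ f p)
    (d : ℤ) : f ∘ₗ treePart ℰ d = if d = p then f else 0 := by
  refine hom_ext (ℰ := ℰ) fun d' x hx => ?_
  by_cases h : d' = d
  · subst h
    rw [LinearMap.comp_apply, treePart_of_mem hx]
    split_ifs with h
    · rfl
    · exact hf _ h x hx
  · rw [LinearMap.comp_apply, treePart_of_mem_ne h hx, map_zero]
    split_ifs with hp
    · exact (hf _ (hp ▸ h) x hx).symm
    · rfl

theorem treePart_graftMap {j : ℕ} {a b : ℤ} {x y : Trees K E} (hx : x ∈ treeGrading ℰ a)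
    (hy : y ∈ treeGrading ℰ b) (d : ℤ) :
    treePart ℰ d (graftMap j x y) = if a + b + j = d then graftMap j x y else 0 := by
  split_ifs with h
  · exact treePart_of_mem (h ▸ graftMap_mem_treeGrading hx hy)
  · exact treePart_of_mem_ne h (graftMap_mem_treeGrading hx hy)

theorem treePart_leafTree {n : ℤ} {e : E} (he : e ∈ ℰ n) (d : ℤ) :
    treePart ℰ d (leafTree K E e) = if 1 - n = d then leafTree K E e else 0 := by
  split_ifs with h
  · exact treePart_of_mem (h ▸ leafTree_mem_treeGrading he)
  · exact treePart_of_mem_ne h (leafTree_mem_treeGrading he)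

/-- Degrees add up under grafting, so the total degree and the degree of the right branch determine
the degree of the left branch. This handles the ideal, whose elements may have inhomogeneous
factors. -/
theorem treeMul_comp_treePart_left (i : ℕ) (f g : Module.Dual K (Trees K E)) (d q : ℤ) :
    treeMul i f (g ∘ₗ treePart ℰ q) ∘ₗ treePart ℰ d =
      treeMul i (f ∘ₗ treePart ℰ (d - i - q)) (g ∘ₗ treePart ℰ q) := by
  refine hom_graft_ext (ℰ := ℰ) (fun n e he => ?_) fun j a b x hx y hy _ _ => ?_
  · rw [LinearMap.comp_apply, treePart_leafTree he]
    split_ifs <;> simp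
  · rw [LinearMap.comp_apply, treePart_graftMap hx hy, apply_ite (treeMul i f _), map_zero,
      treeMul_graftMap, treeMul_graftMap]
    by_cases hj : j = i
    · subst hj
      by_cases hb : b = q
      · subst hb
        by_cases ha : a = d - j - b
        · subst ha
          simp [treePart_of_mem hx]
        · have : ¬ a + b + j = d := by omega
          simp [this, treePart_of_mem_ne ha hx]
      · simp [treePart_of_mem_ne hb hy]
    · simp [hj]

theorem treeMul_comp_treePart_right (i : ℕ) (f g : Module.Dual K (Trees K E)) (d p : ℤ) :
    treeMul i (f ∘ₗ treePart ℰ p) g ∘ₗ treePart ℰ d =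
      treeMul i (f ∘ₗ treePart ℰ p) (g ∘ₗ treePart ℰ (d - i - p)) := by
  refine hom_graft_ext (ℰ := ℰ) (fun n e he => ?_) fun j a b x hx y hy _ _ => ?_
  · rw [LinearMap.comp_apply, treePart_leafTree he]
    split_ifs <;> simp
  · rw [LinearMap.comp_apply, treePart_graftMap hx hy, apply_ite (treeMul i _ g), map_zero,
      treeMul_graftMap, treeMul_graftMap]
    by_cases hj : j = i
    · subst hj
      by_cases ha : a = p
      · subst ha
        by_cases hb : b = d - j - a
        · subst hb
          simp [treePart_of_mem hy]
        · have : ¬ a + b + j = d := by omega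
          simp [this, treePart_of_mem_ne hb hy]
      · simp [treePart_of_mem_ne ha hx]
    · simp [hj]

theorem apply_eq_zero_of_treePart {f : Module.Dual K (Trees K E)} {x : Trees K E}
    (h : ∀ d, f (treePart ℰ d x) = 0) : f x = 0 :=
  mem_of_treePart_mem (ℰ := ℰ) (S := LinearMap.ker f) h

/-- Products of homogeneous functionals detect everything but the leaves. -/
theorem eq_leafTree_of_homogeneous {x : Trees K E}
    (h : ∀ i p q f g, TreeDegree ℰ f p → TreeDegree ℰ g q → treeMul i f g x = 0) :
    x = leafTree K E (leafPart K E x) := by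
  refine eq_leafTree_of_treeMul_eq_zero fun i f g => ?_
  obtain ⟨L, hL⟩ := exists_contractLeft i f
  rw [← hL]
  refine apply_eq_zero_of_treePart (ℰ := ℰ) fun q => ?_
  rw [← LinearMap.comp_apply, hL]
  obtain ⟨R, hR⟩ := exists_contractRight i (g ∘ₗ treePart ℰ q)
  rw [← hR]
  refine apply_eq_zero_of_treePart (ℰ := ℰ) fun p => ?_
  rw [← LinearMap.comp_apply, hR]
  exact h _ _ _ _ _ (treeDegree_comp_treePart _ _) (treeDegree_comp_treePart _ _)

/-- Functionals of homogeneous degree are compatible with the vanishing on homogeneous parts. -/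
theorem TreeDegree.apply_treePart {f : Module.Dual K (Trees K E)} {p : ℤ} (hf : TreeDegree ℰ f p)
    {x : Trees K E} (hx : f x = 0) (d : ℤ) : f (treePart ℰ d x) = 0 := by
  rw [← LinearMap.comp_apply, hf.comp_treePart]
  split_ifs <;> simp [hx]

/-- The Chevalley-Eilenberg coalgebra is a graded subspace of the space of trees. -/
theorem treePart_mem_CECoalg {x : Trees K E} (hx : x ∈ CECoalg ℰ) (d : ℤ) :
    treePart ℰ d x ∈ CECoalg ℰ := by
  intro f hf
  induction hf generalizing x d with
  | eq i p q a b c r ha hb hc =>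
    exact (ha.relEq hb hc i).apply_treePart (hx _ (.eq i p q a b c r ha hb hc)) d
  | lt i j p q r a b c hij ha hb hc =>
    exact (ha.relLt hb hc i j).apply_treePart (hx _ (.lt i j p q r a b c hij ha hb hc)) d
  | gt i j p q r a b c hij ha hb hc =>
    exact (ha.relGt hb hc hij).apply_treePart (hx _ (.gt i j p q r a b c hij ha hb hc)) d
  | add f g _ _ hf hg => rw [LinearMap.add_apply, hf hx d, hg hx d, add_zero]
  | smul k f _ hf => rw [LinearMap.smul_apply, hf hx d, smul_zero]
  | mulLeft i f g hg ih =>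
    -- The factor `f` need not be homogeneous. Fixing the degree `q` of the other branch replaces
    -- `f` by one of its homogeneous parts. Contracting `x` with that part stays in the coalgebra,
    -- so the induction hypothesis applies to `g`.
    obtain ⟨L, hL⟩ := exists_contractLeft i f
    rw [← hL]
    refine apply_eq_zero_of_treePart (ℰ := ℰ) fun q => ?_
    rw [← LinearMap.comp_apply, hL, ← LinearMap.comp_apply, treeMul_comp_treePart_left]
    obtain ⟨L', hL'⟩ := exists_contractLeft i (f ∘ₗ treePart ℰ (d - i - q))
    rw [← hL', LinearMap.comp_apply]
    exact ih (fun φ hφ => by rw [hL']; exact hx _ (.mulLeft i _ _ hφ)) q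
  | mulRight i f g hf ih =>
    obtain ⟨R, hR⟩ := exists_contractRight i g
    rw [← hR]
    refine apply_eq_zero_of_treePart (ℰ := ℰ) fun q => ?_
    rw [← LinearMap.comp_apply, hR, ← LinearMap.comp_apply, treeMul_comp_treePart_right]
    obtain ⟨R', hR'⟩ := exists_contractRight i (g ∘ₗ treePart ℰ (d - i - q))
    rw [← hR', LinearMap.comp_apply]
    exact ih (fun φ hφ => by rw [hR']; exact hx _ (.mulRight i _ _ hφ)) q

variable (ℰ)

/-- The projection of all trees onto the Chevalley-Eilenberg coalgebra, as a map of degree `0`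
of the space of trees to itself. -/
def homProjAux : Trees K E →ₗ[K] Trees K E :=
  (Finsupp.lsum K fun d : ℤ => treePart ℰ d ∘ₗ (CECoalg ℰ).subtype ∘ₗ ceProj ℰ) ∘ₗ treeDecomp ℰ

theorem homProjAux_mem (x : Trees K E) : homProjAux ℰ x ∈ CECoalg ℰ := by
  refine hom_induction (ℰ := ℰ) ((CECoalg ℰ).comap (homProjAux ℰ)) (fun d x hx => ?_) x
  simpa [homProjAux, treeDecomp_of_mem hx] using treePart_mem_CECoalg (ceProj ℰ x).2 d

/-- A projection of degree `0` of all trees onto the Chevalley-Eilenberg coalgebra. -/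
def homProj : Trees K E →ₗ[K] CECoalg ℰ := (homProjAux ℰ).codRestrict _ (homProjAux_mem ℰ)

variable {ℰ}

theorem homProj_mem {d : ℤ} {x : Trees K E} (hx : x ∈ treeGrading ℰ d) :
    homProj ℰ x ∈ ceGrading ℰ d := by
  change homProjAux ℰ x ∈ treeGrading ℰ d
  simpa [homProjAux, treeDecomp_of_mem hx] using treePart_mem d _

-- The homogeneous parts of an element of the coalgebra are again in the coalgebra, where `ceProj`
-- is the identity. So forcing the projection to preserve degrees does not spoil it.
@[simp]
theorem homProj_coe (x : CECoalg ℰ) : homProj ℰ (x : Trees K E) = x := by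
  refine Subtype.ext ?_
  change homProjAux ℰ x = x
  conv_rhs => rw [← sum_treePart (ℰ := ℰ) (x : Trees K E)]
  refine Finset.sum_congr rfl fun d _ => ?_
  have := ceProj_apply ℰ ⟨_, treePart_mem_CECoalg x.2 d⟩
  change treePart ℰ d (ceProj ℰ (treePart ℰ d x)) = _
  rw [this]
  exact treePart_of_mem (treePart_mem d _)

variable (ℰ)

/-- The sign operator `x ↦ (-1)^{|x|} x` on trees. -/
def treeSign : Trees K E →ₗ[K] Trees K E :=
  (Finsupp.lsum K fun d : ℤ => Int.negOnePow d • LinearMap.id) ∘ₗ treeDecomp ℰ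

variable {ℰ}

theorem treeSign_of_mem {d : ℤ} {x : Trees K E} (hx : x ∈ treeGrading ℰ d) :
    treeSign ℰ x = Int.negOnePow d • x := by
  simp [treeSign, treeDecomp_of_mem hx]

theorem TreeDegree.comp_treeSign {f : Module.Dual K (Trees K E)} {p : ℤ} (hf : TreeDegree ℰ f p) :
    f ∘ₗ treeSign ℰ = Int.negOnePow p • f := by
  refine hom_ext (ℰ := ℰ) fun d x hx => ?_
  rw [LinearMap.comp_apply, treeSign_of_mem hx, LinearMap.smul_apply]
  by_cases h : d = p
  · rw [h]
    simp [Units.smul_def]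
  · rw [hf d h x hx, smul_zero, Units.smul_def, map_zsmul, hf d h x hx, smul_zero]

theorem treeSign_mem_CECoalg {x : Trees K E} (hx : x ∈ CECoalg ℰ) : treeSign ℰ x ∈ CECoalg ℰ := by
  change Finsupp.lsum K _ (treeDecomp ℰ x) ∈ _
  rw [Finsupp.lsum_apply]
  refine Submodule.finsuppSum_mem _ _ _ _ fun d _ => ?_
  rw [LinearMap.smul_apply, Units.smul_def]
  exact zsmul_mem (treePart_mem_CECoalg hx d) _

end Decomposition

end Grading

set_option linter.unusedSimpArgs false

/-! ### Sign computations for odd derivations and the deformed Leibniz rule -/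

section Signs

/-- In this form every sign depends only on parities, and the sign identities below become finite
case distinctions. -/
theorem negOnePow_eq_ite (n : ℤ) : Int.negOnePow n = if Even n then 1 else -1 := by
  split_ifs with h
  · exact Int.negOnePow_even n h
  · exact Int.negOnePow_odd n (Int.not_even_iff_odd.1 h)

variable {M : Type*} [AddCommGroup M] {m : ℕ → M →+ M →+ M} {deg : ℤ → M → Prop} {Q R : M →+ M}

theorem map_units_smul (f : M →+ M) (s : ℤˣ) (x : M) : f (s • x) = s • f x := by
  simp only [Units.smul_def, map_zsmul]

theorem map_units_smul_left (f : M →+ M →+ M) (s : ℤˣ) (x y : M) : f (s • x) y = s • f x y := by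
  simp only [Units.smul_def, map_zsmul, AddMonoidHom.smul_apply]

/-- An odd derivation is compatible with the first kind of relations. -/
theorem derivation_relEq
    (hm : ∀ (i : ℕ) p q a b, deg p a → deg q b → deg (p + q + i) (m i a b))
    (hQ : ∀ i p a b, deg p a →
      Q (m i a b) = Int.negOnePow i • (m i (Q a) b + Int.negOnePow p • m i a (Q b)))
    {k : ℤ} (hk : Odd k) (i : ℕ) {p q : ℤ} {a b : M} (c : M) (ha : deg p a) (hb : deg q b) :
    Q (relEq (fun i a b => m i a b) i p q a b c) =
      Int.negOnePow i • relEq (fun i a b => m i a b) i (p - k) q (Q a) b c +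
      Int.negOnePow p • relEq (fun i a b => m i a b) i p (q - k) a (Q b) c +
      Int.negOnePow (p + q) • relEq (fun i a b => m i a b) i p q a b (Q c) := by
  have hk : ¬ Even k := Int.not_even_iff_odd.2 hk
  simp only [relEq, map_sub, map_add, map_units_smul, hQ _ _ _ _ ha, hQ _ _ _ _ hb,
    hQ _ _ _ _ (hm i _ _ _ _ ha hb), hQ _ _ _ _ (hm i _ _ _ _ hb ha), AddMonoidHom.add_apply,
    map_units_smul_left]
  by_cases hi : Even (i : ℤ) <;> by_cases hp : Even p <;> by_cases hq : Even q <;>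
    simp only [negOnePow_eq_ite, hi, hp, hq, hk, Int.even_add, Int.even_sub,
      Int.even_mul, Int.not_even_one, Nat.cast_add, Nat.cast_one, iff_true, true_iff, iff_false, false_iff,
      not_true_eq_false, not_false_eq_true, or_true, true_or, or_false, false_or, if_true, if_false,
      one_smul, Units.neg_smul, smul_zero] <;> abel

/-- An odd derivation is compatible with the second kind of relations. -/
theorem derivation_relLt
    (hm : ∀ (i : ℕ) p q a b, deg p a → deg q b → deg (p + q + i) (m i a b))
    (hQ : ∀ i p a b, deg p a →
      Q (m i a b) = Int.negOnePow i • (m i (Q a) b + Int.negOnePow p • m i a (Q b)))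
    {k : ℤ} (hk : Odd k) (i j : ℕ) {p q : ℤ} {a b : M} (c : M) (ha : deg p a) (hb : deg q b) :
    Q (relLt (fun i a b => m i a b) i j p a b c) =
      Int.negOnePow i • relLt (fun i a b => m i a b) i j (p - k) (Q a) b c +
      Int.negOnePow (i + p + j) • relLt (fun i a b => m i a b) i j p a (Q b) c +
      Int.negOnePow (i + p + j + q) • relLt (fun i a b => m i a b) i j p a b (Q c) := by
  have hk : ¬ Even k := Int.not_even_iff_odd.2 hk
  simp only [relLt, map_sub, map_add, map_units_smul, hQ _ _ _ _ ha, hQ _ _ _ _ hb,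
    hQ _ _ _ _ (hm i _ _ _ _ ha hb), AddMonoidHom.add_apply, map_units_smul_left]
  by_cases hi : Even (i : ℤ) <;> by_cases hj : Even (j : ℤ) <;> by_cases hp : Even p <;>
    by_cases hq : Even q <;>
    simp only [negOnePow_eq_ite, hi, hj, hp, hq, hk, Int.even_add, Int.even_sub,
      Int.even_mul, Int.not_even_one, Nat.cast_add, Nat.cast_one, iff_true, true_iff, iff_false, false_iff,
      not_true_eq_false, not_false_eq_true, or_true, true_or, or_false, false_or, if_true, if_false,
      one_smul, Units.neg_smul, smul_zero] <;> abel

/-- An odd derivation is compatible with the third kind of relations. -/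
theorem derivation_relGt
    (hm : ∀ (i : ℕ) p q a b, deg p a → deg q b → deg (p + q + i) (m i a b))
    (hQ : ∀ i p a b, deg p a →
      Q (m i a b) = Int.negOnePow i • (m i (Q a) b + Int.negOnePow p • m i a (Q b)))
    {k : ℤ} (hk : Odd k) {i j : ℕ} (hij : i < j) {p q r : ℤ} {a b c : M} (ha : deg p a)
    (hb : deg q b) (hc : deg r c) :
    Q (relGt (fun i a b => m i a b) i j p q r a b c) =
      Int.negOnePow j • relGt (fun i a b => m i a b) i j (p - k) q r (Q a) b c +
      Int.negOnePow (i + p + j) • relGt (fun i a b => m i a b) i j p (q - k) r a (Q b) c +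
      Int.negOnePow (i + p + j + q) • relGt (fun i a b => m i a b) i j p q (r - k) a b (Q c) := by
  have hk : ¬ Even k := Int.not_even_iff_odd.2 hk
  -- The relation contains the label `j - 1`; the shift removes the truncated subtraction.
  obtain ⟨j, rfl⟩ : ∃ n, j = n + 1 := ⟨j - 1, by omega⟩
  simp only [relGt, Nat.add_sub_cancel]
  by_cases h1 : i + 2 ≤ j + 1 <;> by_cases h2 : i + 2 < j + 1 <;>
  simp only [h1, h2, if_true, if_false, map_sub, map_add, map_units_smul, hQ _ _ _ _ ha,
    hQ _ _ _ _ hb, hQ _ _ _ _ hc, hQ _ _ _ _ (hm i _ _ _ _ hb ha),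
    hQ _ _ _ _ (hm j _ _ _ _ hc ha), hQ _ _ _ _ (hm (i + 1) _ _ _ _ hc hb),
    AddMonoidHom.add_apply, map_units_smul_left, map_zero] <;>
  by_cases hi : Even (i : ℤ) <;> by_cases hj : Even (j : ℤ) <;> by_cases hp : Even p <;>
    by_cases hq : Even q <;> by_cases hr : Even r <;>
    simp only [negOnePow_eq_ite, hi, hj, hp, hq, hr, hk, Int.even_add, Int.even_sub,
      Int.even_mul, Int.not_even_one, Nat.cast_add, Nat.cast_one, iff_true, true_iff, iff_false, false_iff,
      not_true_eq_false, not_false_eq_true, or_true, true_or, or_false, false_or, if_true, if_false,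
      one_smul, Units.neg_smul, smul_zero] <;>
    abel

/-- The square of a map that obeys the deformed Leibniz rule is a derivation. -/
theorem deformedLeibniz_sq
    (hdeg : ∀ p a, deg p a → deg (p + 1) (Q a))
    (hQ : ∀ i p q a b, deg p a → deg q b → DeformedLeibniz (fun i a b => m i a b) Q i p q a b)
    (i : ℕ) {p q : ℤ} {a b : M} (ha : deg p a) (hb : deg q b) :
    Q (Q (m i a b)) = m i (Q (Q a)) b + m i a (Q (Q b)) := by
  simp only [DeformedLeibniz] at hQ
  simp only [map_sub, map_add, map_units_smul, hQ _ _ _ _ _ ha hb, hQ _ _ _ _ _ hb ha,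
    hQ _ _ _ _ _ (hdeg _ _ ha) hb, hQ _ _ _ _ _ ha (hdeg _ _ hb)]
  -- The terms with `⊘_{i+1}` and `⊘_{i+2}` cancel in pairs. The rule was also needed for the
  -- swapped pair `b`, `a`, which appears in the correction term.
  by_cases hi : Even (i : ℤ) <;> by_cases hp : Even p <;> by_cases hq : Even q <;>
    simp only [negOnePow_eq_ite, hi, hp, hq, Int.even_add, Int.even_sub,
      Int.even_mul, Int.not_even_one, Nat.cast_add, Nat.cast_one, iff_true, true_iff, iff_false, false_iff,
      not_true_eq_false, not_false_eq_true, or_true, true_or, or_false, false_or, if_true, if_false,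
      one_smul, Units.neg_smul, smul_zero] <;> abel

/-- The anticommutator of a map that obeys the deformed Leibniz rule and of an odd derivation is a
derivation. -/
theorem deformedLeibniz_anticommutator
    (hdeg : ∀ p a, deg p a → deg (p + 1) (Q a))
    (hdeg' : ∀ p a, deg p a → deg (p - 1) (R a))
    (hQ : ∀ i p q a b, deg p a → deg q b → DeformedLeibniz (fun i a b => m i a b) Q i p q a b)
    (hR : ∀ i p q a b, deg p a → deg q b →
      R (m i a b) = Int.negOnePow i • (m i (R a) b + Int.negOnePow p • m i a (R b)))
    (i : ℕ) {p q : ℤ} {a b : M} (ha : deg p a) (hb : deg q b) :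
    R (Q (m i a b)) + Q (R (m i a b)) =
      m i (R (Q a) + Q (R a)) b + m i a (R (Q b) + Q (R b)) := by
  simp only [DeformedLeibniz] at hQ
  simp only [map_sub, map_add, map_units_smul, hQ _ _ _ _ _ ha hb, hR _ _ _ _ _ ha hb,
    hR _ _ _ _ _ hb ha, hR _ _ _ _ _ (hdeg _ _ ha) hb, hR _ _ _ _ _ ha (hdeg _ _ hb),
    hQ _ _ _ _ _ (hdeg' _ _ ha) hb, hQ _ _ _ _ _ ha (hdeg' _ _ hb), AddMonoidHom.add_apply]
  -- Moving `R` past `⊘_{i+1}` costs the opposite sign to moving it past `⊘_i`, so the correction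
  -- terms of the two orders of composition cancel.
  by_cases hi : Even (i : ℤ) <;> by_cases hp : Even p <;> by_cases hq : Even q <;>
    simp only [negOnePow_eq_ite, hi, hp, hq, Int.even_add, Int.even_sub,
      Int.even_mul, Int.not_even_one, Nat.cast_add, Nat.cast_one, iff_true, true_iff, iff_false, false_iff,
      not_true_eq_false, not_false_eq_true, or_true, true_or, or_false, false_or, if_true, if_false,
      one_smul, Units.neg_smul, smul_zero] <;> abel

end Signs

/-! ### Biadditivity of the products -/

section Bilinear

variable {K : Type v} [Field K] {E : Type u} [AddCommGroup E] [Module K E] {ℰ : ℤ → Submodule K E}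

theorem treeMul_add_left (i : ℕ) (f f' g : Module.Dual K (Trees K E)) :
    treeMul i (f + f') g = treeMul i f g + treeMul i f' g :=
  tree_ext (by simp) fun j x y _ _ => by
    simp only [treeMul_graftMap, LinearMap.add_apply]
    split_ifs <;> ring

theorem treeMul_add_right (i : ℕ) (f g g' : Module.Dual K (Trees K E)) :
    treeMul i f (g + g') = treeMul i f g + treeMul i f g' :=
  tree_ext (by simp) fun j x y _ _ => by
    simp only [treeMul_graftMap, LinearMap.add_apply]
    split_ifs <;> ring

/-- The products of functionals on trees, as biadditive maps. -/
def treeMulHom (i : ℕ) :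
    Module.Dual K (Trees K E) →+ Module.Dual K (Trees K E) →+ Module.Dual K (Trees K E) :=
  AddMonoidHom.mk' (fun f => AddMonoidHom.mk' (treeMul i f) (treeMul_add_right i f))
    fun f f' => AddMonoidHom.ext fun g => treeMul_add_left i f f' g

/-- The products of the Chevalley-Eilenberg algebra, as biadditive maps. -/
def ceMulHom (i : ℕ) : CE ℰ →+ CE ℰ →+ CE ℰ :=
  AddMonoidHom.mk' (fun f => AddMonoidHom.mk' (ceMul ℰ i f) fun g g' => by
      rw [ceMul, LinearMap.add_comp, treeMul_add_right, LinearMap.add_comp]; rfl)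
    fun f f' => AddMonoidHom.ext fun g => by
      change ceMul ℰ i (f + f') g = ceMul ℰ i f g + ceMul ℰ i f' g
      rw [ceMul, LinearMap.add_comp, treeMul_add_left, LinearMap.add_comp]; rfl

theorem ceMulHom_apply (i : ℕ) (f g : CE ℰ) : ceMulHom i f g = ceMul ℰ i f g := rfl

/-- The transpose of a linear map. -/
def compHom {U V W : Type*} [AddCommGroup U] [Module K U] [AddCommGroup V] [Module K V]
    [AddCommGroup W] [Module K W] (δ : U →ₗ[K] V) : (V →ₗ[K] W) →+ (U →ₗ[K] W) :=
  AddMonoidHom.mk' (fun f => f ∘ₗ δ) fun f g => LinearMap.add_comp δ g f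

theorem RelIdeal.units_smul {f : Module.Dual K (Trees K E)} (hf : RelIdeal ℰ f) (s : ℤˣ) :
    RelIdeal ℰ (s • f) := by
  rcases Int.units_eq_one_or s with rfl | rfl
  · rwa [one_smul]
  · rw [Units.neg_smul, one_smul, ← neg_one_smul K]
    exact .smul _ _ hf

end Bilinear

/-! ### Morphisms of coalgebras with prescribed components -/

section CoalgMap

variable {K : Type v} [Field K] {E : Type u} [AddCommGroup E] [Module K E] {ℰ : ℤ → Submodule K E}
  {E' : Type u} [AddCommGroup E'] [Module K E'] {ℰ' : ℤ → Submodule K E'}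

/-- The morphism of coalgebras with linear component `a` whose higher components are given,
recursively, by evaluating `w` on the part of the value that consists of at least two leaves. -/
def coalgMap (a : E →ₗ[K] E') (w : Trees K E' →ₗ[K] E') : Trees K E →ₗ[K] Trees K E' :=
  treeRec (leafTree K E' ∘ₗ a) fun j =>
    (graftMap j).compr₂ (LinearMap.id + leafTree K E' ∘ₗ w)

variable (a : E →ₗ[K] E') (w : Trees K E' →ₗ[K] E')

@[simp]
theorem coalgMap_leafTree (e : E) : coalgMap a w (leafTree K E e) = leafTree K E' (a e) := by
  simp [coalgMap]

theorem coalgMap_graftMap (j : ℕ) (x y : Trees K E) :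
    coalgMap a w (graftMap j x y) = graftMap j (coalgMap a w x) (coalgMap a w y) +
      leafTree K E' (w (graftMap j (coalgMap a w x) (coalgMap a w y))) := by
  simp [coalgMap]

/-- Products of functionals vanish on leaves, so they do not see the recursive correction, which is
always a leaf. Hence `w` may be arbitrary here. -/
theorem treeMul_comp_coalgMap (i : ℕ) (f g : Module.Dual K (Trees K E')) :
    treeMul i f g ∘ₗ coalgMap a w = treeMul i (f ∘ₗ coalgMap a w) (g ∘ₗ coalgMap a w) :=
  tree_ext (by simp) fun j x y _ _ => by simp [coalgMap_graftMap]

/-- If `w` ignores leaves, then evaluating it on the graft alone is the same as evaluating it on the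
full value. The recursion thus solves an equation in which the unknown morphism occurs on both
sides; the minimal model is obtained by solving such an equation. -/
theorem leafPart_coalgMap {a : E →ₗ[K] E'} {w : Trees K E' →ₗ[K] E'}
    (hw : ∀ e, w (leafTree K E' e) = 0) (x : Trees K E) :
    leafPart K E' (coalgMap a w x) = a (leafPart K E x) + w (coalgMap a w x) := by
  have : leafPart K E' ∘ₗ coalgMap a w = a ∘ₗ leafPart K E + w ∘ₗ coalgMap a w :=
    tree_ext (by simp [hw]) fun j x y _ _ => by simp [coalgMap_graftMap, hw]
  exact LinearMap.congr_fun this x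

variable {a w} (ha : ∀ n, ∀ e ∈ ℰ n, a e ∈ ℰ' n)
  (hw : ∀ d, ∀ x ∈ treeGrading ℰ' d, w x ∈ ℰ' (1 - d))
include ha hw

theorem coalgMap_mem_treeGrading {d : ℤ} {x : Trees K E} (hx : x ∈ treeGrading ℰ d) :
    coalgMap a w x ∈ treeGrading ℰ' d := by
  refine treeGrading_induction (ℰ := ℰ) (fun d => (treeGrading ℰ' d).comap (coalgMap a w))
    (fun n e he => ?_) (fun j p q x _ y _ hx hy => ?_) d hx
  · rw [Submodule.mem_comap, coalgMap_leafTree]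
    exact leafTree_mem_treeGrading (ha n e he)
  · rw [Submodule.mem_comap, coalgMap_graftMap]
    have h := graftMap_mem_treeGrading (j := j) hx hy
    refine add_mem h ?_
    have := leafTree_mem_treeGrading (hw _ _ h)
    rwa [sub_sub_cancel] at this

theorem TreeDegree.comp_coalgMap {f : Module.Dual K (Trees K E')} {p : ℤ}
    (hf : TreeDegree ℰ' f p) : TreeDegree ℰ (f ∘ₗ coalgMap a w) p := fun d hd _ hx =>
  hf d hd _ (coalgMap_mem_treeGrading ha hw hx)

/-- Pullback preserves products and degrees, so it sends each generating relation to a relation of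
the same kind. Dually, the morphism restricts to the Chevalley-Eilenberg coalgebras without any
condition on its components beyond their degrees. -/
theorem RelIdeal.comp_coalgMap {f : Module.Dual K (Trees K E')} (hf : RelIdeal ℰ' f) :
    RelIdeal ℰ (f ∘ₗ coalgMap a w) := by
  have hmul := treeMul_comp_coalgMap a w
  have hsmul (s : ℤˣ) (f : Module.Dual K (Trees K E')) :
      (s • f) ∘ₗ coalgMap a w = s • (f ∘ₗ coalgMap a w) := LinearMap.smul_comp ..
  induction hf with
  | eq i p q a b c r ha' hb' hc' =>
    simp only [relEq, LinearMap.sub_comp, LinearMap.add_comp, hsmul, hmul]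
    exact .eq i p q _ _ _ r (ha'.comp_coalgMap ha hw) (hb'.comp_coalgMap ha hw)
      (hc'.comp_coalgMap ha hw)
  | lt i j p q r a b c hij ha' hb' hc' =>
    simp only [relLt, LinearMap.sub_comp, hsmul, hmul]
    exact .lt i j p q r _ _ _ hij (ha'.comp_coalgMap ha hw) (hb'.comp_coalgMap ha hw)
      (hc'.comp_coalgMap ha hw)
  | gt i j p q r a b c hij ha' hb' hc' =>
    have := RelIdeal.gt i j p q r _ _ _ hij (ha'.comp_coalgMap ha hw) (hb'.comp_coalgMap ha hw)
      (hc'.comp_coalgMap ha hw)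
    simp only [relGt, LinearMap.sub_comp, LinearMap.add_comp, hsmul, hmul] at this ⊢
    convert this using 4 <;> split_ifs <;> simp [hsmul, hmul]
  | add f g _ _ hf hg => exact .add _ _ hf hg
  | smul k f _ hf => exact .smul k _ hf
  | mulLeft i f g _ hg =>
    rw [hmul]
    exact .mulLeft i _ _ hg
  | mulRight i f g _ hf =>
    rw [hmul]
    exact .mulRight i _ _ hf

theorem coalgMap_mem_CECoalg {x : Trees K E} (hx : x ∈ CECoalg ℰ) :
    coalgMap a w x ∈ CECoalg ℰ' := fun _ hf =>
  hx _ (hf.comp_coalgMap ha hw)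

end CoalgMap

/-! ### Coderivations with prescribed components -/

section Coder

variable {K : Type v} [Field K] {E : Type u} [AddCommGroup E] [Module K E] {ℰ : ℤ → Submodule K E}

/-- The pair of the identity and of `coder s τ u`. -/
def coderAux (s : ℕ → ℤˣ) (τ : Trees K E →ₗ[K] Trees K E) (u : Trees K E →ₗ[K] E) :
    Trees K E →ₗ[K] Trees K E × Trees K E :=
  treeRec (LinearMap.prod (leafTree K E) (leafTree K E ∘ₗ u ∘ₗ leafTree K E)) fun j =>
    ((graftMap j).compl₁₂ (LinearMap.fst K _ _) (LinearMap.fst K _ _)).compr₂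
      (LinearMap.prod LinearMap.id (leafTree K E ∘ₗ u)) +
    s j • ((graftMap j).compl₁₂ (LinearMap.snd K _ _) (LinearMap.fst K _ _) +
      (graftMap j).compl₁₂ (τ ∘ₗ LinearMap.fst K _ _) (LinearMap.snd K _ _)).compr₂
        (LinearMap.inr K (Trees K E) (Trees K E))

/-- The coderivation of the space of trees with components `u`, where `s` and `τ` are the signs. -/
def coder (s : ℕ → ℤˣ) (τ : Trees K E →ₗ[K] Trees K E) (u : Trees K E →ₗ[K] E) :
    Trees K E →ₗ[K] Trees K E :=
  LinearMap.snd K _ _ ∘ₗ coderAux s τ u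

variable (s : ℕ → ℤˣ) (τ : Trees K E →ₗ[K] Trees K E) (u : Trees K E →ₗ[K] E)

@[simp]
theorem coder_leafTree (e : E) :
    coder s τ u (leafTree K E e) = leafTree K E (u (leafTree K E e)) := by
  simp [coder, coderAux]

theorem coderAux_graftMap (j : ℕ) (x y : Trees K E) :
    coderAux s τ u (graftMap j x y) = (graftMap j (coderAux s τ u x).1 (coderAux s τ u y).1,
      leafTree K E (u (graftMap j (coderAux s τ u x).1 (coderAux s τ u y).1)) +
        s j • (graftMap j (coderAux s τ u x).2 (coderAux s τ u y).1 +
          graftMap j (τ (coderAux s τ u x).1) (coderAux s τ u y).2)) := by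
  rw [coderAux, treeRec_graftMap, ← coderAux]
  refine Prod.ext ?_ ?_ <;> simp [Units.smul_def]

/-- The co-Leibniz rule on a graft needs the branches themselves besides their images, and plain
recursion forgets them. The first component of the pair carries them along. -/
theorem coderAux_fst (x : Trees K E) : (coderAux s τ u x).1 = x := by
  have : LinearMap.fst K _ _ ∘ₗ coderAux s τ u = LinearMap.id := by
    refine tree_ext (fun e => by simp [coderAux]) fun j x y hx hy => ?_
    rw [LinearMap.comp_apply, LinearMap.fst_apply, LinearMap.id_apply] at hx hy
    rw [LinearMap.comp_apply, LinearMap.fst_apply, coderAux_graftMap, hx, hy, LinearMap.id_apply]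
  exact LinearMap.congr_fun this x

theorem coder_graftMap (j : ℕ) (x y : Trees K E) :
    coder s τ u (graftMap j x y) = leafTree K E (u (graftMap j x y)) +
      s j • (graftMap j (coder s τ u x) y + graftMap j (τ x) (coder s τ u y)) := by
  rw [coder, LinearMap.comp_apply, coderAux_graftMap, coderAux_fst, coderAux_fst]
  rfl

@[simp]
theorem leafPart_coder (x : Trees K E) : leafPart K E (coder s τ u x) = u x := by
  have : leafPart K E ∘ₗ coder s τ u = u :=
    tree_ext (by simp) fun j x y _ _ => by simp [coder_graftMap, Units.smul_def]
  exact LinearMap.congr_fun this x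

/-- The components `u` contribute only leaves to the image of a graft, and products do not see
leaves. -/
theorem treeMul_comp_coder (i : ℕ) (f g : Module.Dual K (Trees K E)) :
    treeMul i f g ∘ₗ coder s τ u = s i • (treeMul i (f ∘ₗ coder s τ u) g +
      treeMul i (f ∘ₗ τ) (g ∘ₗ coder s τ u)) := by
  refine tree_ext (by simp [Units.smul_def]) fun j x y _ _ => ?_
  by_cases h : j = i
  · subst h
    simp [coder_graftMap, Units.smul_def]
  · simp [coder_graftMap, Units.smul_def, h]

section Odd

variable [DirectSum.Decomposition ℰ] (ℰ)

/-- The odd coderivation of the space of trees with components `u`. -/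
def oddCoder : Trees K E →ₗ[K] Trees K E := coder (fun i => Int.negOnePow i) (treeSign ℰ) u

variable {ℰ u} {k : ℤ}

theorem treeMul_comp_oddCoder (i : ℕ) {p : ℤ} {f : Module.Dual K (Trees K E)}
    (hf : TreeDegree ℰ f p) (g : Module.Dual K (Trees K E)) :
    treeMul i f g ∘ₗ oddCoder ℰ u = Int.negOnePow i • (treeMul i (f ∘ₗ oddCoder ℰ u) g +
      Int.negOnePow p • treeMul i f (g ∘ₗ oddCoder ℰ u)) := by
  rw [oddCoder, treeMul_comp_coder, hf.comp_treeSign]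
  congr 2
  exact map_units_smul_left (M := Module.Dual K (Trees K E)) (treeMulHom i) _ _ _

theorem oddCoder_mem_treeGrading (hu : ∀ d, ∀ x ∈ treeGrading ℰ d, u x ∈ ℰ (1 - (d + k))) {d : ℤ}
    {x : Trees K E} (hx : x ∈ treeGrading ℰ d) : oddCoder ℰ u x ∈ treeGrading ℰ (d + k) := by
  have key {d : ℤ} {x : Trees K E} (hx : x ∈ treeGrading ℰ d) :
      leafTree K E (u x) ∈ treeGrading ℰ (d + k) := by
    have := leafTree_mem_treeGrading (hu _ _ hx)
    rwa [sub_sub_cancel] at this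
  refine treeGrading_induction (ℰ := ℰ) (fun d => (treeGrading ℰ (d + k)).comap (oddCoder ℰ u))
    (fun n e he => ?_) (fun j p q x hx y hy hx' hy' => ?_) d hx
  · rw [Submodule.mem_comap, oddCoder, coder_leafTree]
    exact key (leafTree_mem_treeGrading he)
  · rw [Submodule.mem_comap, oddCoder, coder_graftMap]
    refine add_mem (key (graftMap_mem_treeGrading hx hy)) ?_
    rw [Units.smul_def]
    refine zsmul_mem (add_mem ?_ ?_) _
    · have := graftMap_mem_treeGrading (j := j) hx' hy
      rwa [show p + k + q + j = p + q + j + k by ring] at this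
    · rw [treeSign_of_mem hx, Units.smul_def, map_zsmul, LinearMap.smul_apply]
      refine zsmul_mem ?_ _
      have := graftMap_mem_treeGrading (j := j) hx hy'
      rwa [show p + (q + k) + j = p + q + j + k by ring] at this

theorem TreeDegree.comp_oddCoder (hu : ∀ d, ∀ x ∈ treeGrading ℰ d, u x ∈ ℰ (1 - (d + k)))
    {f : Module.Dual K (Trees K E)} {p : ℤ} (hf : TreeDegree ℰ f p) :
    TreeDegree ℰ (f ∘ₗ oddCoder ℰ u) (p - k) := fun d hd _ hx =>
  hf (d + k) (fun h => hd (by rw [← h, add_sub_cancel_right])) _ (oddCoder_mem_treeGrading hu hx)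

/-- By the sign computations, the transpose is an odd derivation that sends each generating relation
to a combination of relations. The rest of the ideal follows from the Leibniz rule and contractions.
-/
theorem oddCoder_mem_CECoalg (hu : ∀ d, ∀ x ∈ treeGrading ℰ d, u x ∈ ℰ (1 - (d + k)))
    (hk : Odd k) {x : Trees K E} (hx : x ∈ CECoalg ℰ) : oddCoder ℰ u x ∈ CECoalg ℰ := by
  have hm (i : ℕ) (p q : ℤ) (a b : Module.Dual K (Trees K E)) (ha : TreeDegree ℰ a p)
    (hb : TreeDegree ℰ b q) : TreeDegree ℰ (treeMulHom i a b) (p + q + i) := ha.treeMul hb i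
  have hQ (i : ℕ) (p : ℤ) (a b : Module.Dual K (Trees K E)) (ha : TreeDegree ℰ a p) :
      compHom (oddCoder ℰ u) (treeMulHom i a b) = Int.negOnePow i •
        (treeMulHom i (compHom (oddCoder ℰ u) a) b +
          Int.negOnePow p • treeMulHom i a (compHom (oddCoder ℰ u) b)) :=
    treeMul_comp_oddCoder i ha b
  have hdeg {p : ℤ} {a : Module.Dual K (Trees K E)} (ha : TreeDegree ℰ a p) :
    TreeDegree ℰ (compHom (oddCoder ℰ u) a) (p - k) := ha.comp_oddCoder hu
  intro f hf
  induction hf generalizing x with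
  | eq i p q a b c r ha hb hc =>
    refine (LinearMap.congr_fun (derivation_relEq (m := treeMulHom) hm hQ hk i c ha hb) x).trans ?_
    exact hx _ (.add _ _ (.add _ _ (.units_smul (.eq _ _ _ _ _ _ _ (hdeg ha) hb hc) _)
      (.units_smul (.eq _ _ _ _ _ _ _ ha (hdeg hb) hc) _))
      (.units_smul (.eq _ _ _ _ _ _ _ ha hb (hdeg hc)) _))
  | lt i j p q r a b c hij ha hb hc =>
    refine (LinearMap.congr_fun (derivation_relLt (m := treeMulHom) hm hQ hk i j c ha hb) x).trans ?_
    exact hx _ (.add _ _ (.add _ _ (.units_smul (.lt _ _ _ _ _ _ _ _ hij (hdeg ha) hb hc) _)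
      (.units_smul (.lt _ _ _ _ _ _ _ _ hij ha (hdeg hb) hc) _))
      (.units_smul (.lt _ _ _ _ _ _ _ _ hij ha hb (hdeg hc)) _))
  | gt i j p q r a b c hij ha hb hc =>
    refine (LinearMap.congr_fun
      (derivation_relGt (m := treeMulHom) hm hQ hk hij ha hb hc) x).trans ?_
    exact hx _ (.add _ _ (.add _ _ (.units_smul (.gt _ _ _ _ _ _ _ _ hij (hdeg ha) hb hc) _)
      (.units_smul (.gt _ _ _ _ _ _ _ _ hij ha (hdeg hb) hc) _))
      (.units_smul (.gt _ _ _ _ _ _ _ _ hij ha hb (hdeg hc)) _))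
  | add f g _ _ hf hg => rw [LinearMap.add_apply, hf hx, hg hx, add_zero]
  | smul k f _ hf => rw [LinearMap.smul_apply, hf hx, smul_zero]
  | mulLeft i f g hg ih =>
    rw [← LinearMap.comp_apply, oddCoder, treeMul_comp_coder, Units.smul_def, LinearMap.smul_apply,
      LinearMap.add_apply]
    -- The term in which `f` is differentiated still has the factor `g` from the ideal. In the other
    -- term, contraction with the undifferentiated factor gives an element of the coalgebra, to
    -- which the induction hypothesis applies.
    obtain ⟨L, hL⟩ := exists_contractLeft i (f ∘ₗ treeSign ℰ)
    rw [hx _ (.mulLeft i _ _ hg), ← hL, zero_add]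
    have := ih (x := L x) fun φ hφ => by rw [hL]; exact hx _ (.mulLeft i _ _ hφ)
    rw [oddCoder] at this
    rw [LinearMap.comp_apply, this, smul_zero]
  | mulRight i f g hf ih =>
    rw [← LinearMap.comp_apply, oddCoder, treeMul_comp_coder, Units.smul_def, LinearMap.smul_apply,
      LinearMap.add_apply]
    obtain ⟨R, hR⟩ := exists_contractRight i g
    obtain ⟨R', hR'⟩ := exists_contractRight i (g ∘ₗ coder (fun i => Int.negOnePow i) (treeSign ℰ) u)
    rw [← hR, ← hR', LinearMap.comp_apply, LinearMap.comp_apply]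
    have := ih (x := R x) fun φ hφ => by rw [hR]; exact hx _ (.mulRight i _ _ hφ)
    rw [oddCoder] at this
    rw [this, treeSign_mem_CECoalg (x := R' x) (fun φ hφ => by
      rw [hR']; exact hx _ (.mulRight i _ _ hφ)) _ hf, add_zero, smul_zero]

end Odd

end Coder

/-! ### The filtration by the number of leaves -/

/-- The number of leaves of a tree. -/
def Shape.leaves : Shape → ℕ
  | .leaf => 1
  | .node _ l r => l.leaves + r.leaves

section Arity

variable (K : Type v) [Field K] (E : Type u) [AddCommGroup E] [Module K E]

/-- The space of trees with at most `n` leaves. -/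
def arityFil (n : ℕ) : Submodule K (Trees K E) :=
  ⨆ s : Shape, ⨆ _ : s.leaves ≤ n, LinearMap.range (ofShape K E s)

variable {K E}

theorem ofShape_mem_arityFil {s : Shape} {n : ℕ} (h : s.leaves ≤ n) (x : TreePow K E s) :
    ofShape K E s x ∈ arityFil K E n :=
  Submodule.mem_iSup_of_mem s (Submodule.mem_iSup_of_mem h ⟨x, rfl⟩)

theorem leafTree_mem_arityFil {n : ℕ} (hn : 1 ≤ n) (e : E) : leafTree K E e ∈ arityFil K E n :=
  ofShape_mem_arityFil (s := .leaf) hn _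

theorem arityFil_mono : Monotone (arityFil K E) := fun _ _ hmn =>
  iSup₂_le fun s hs => by
    rintro _ ⟨x, rfl⟩
    exact ofShape_mem_arityFil (hs.trans hmn) x

theorem Shape.leaves_pos (s : Shape) : 1 ≤ s.leaves := by
  induction s with
  | leaf => exact le_rfl
  | node i l r hl hr => exact hl.trans (Nat.le_add_right _ _)

theorem arityFil_zero : arityFil K E 0 = ⊥ := by
  rw [eq_bot_iff]
  exact iSup₂_le fun s hs => absurd hs (by have := s.leaves_pos; omega)

theorem exists_mem_arityFil (x : Trees K E) : ∃ n, x ∈ arityFil K E n := by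
  induction x using DirectSum.induction_on with
  | zero => exact ⟨0, zero_mem _⟩
  | of s x => exact ⟨s.leaves, ofShape_mem_arityFil le_rfl x⟩
  | add x y hx hy =>
    obtain ⟨m, hm⟩ := hx
    obtain ⟨n, hn⟩ := hy
    exact ⟨max m n, add_mem (arityFil_mono (le_max_left m n) hm)
      (arityFil_mono (le_max_right m n) hn)⟩

/-- Induction over trees with control of the number of leaves. -/
theorem arityFil_induction (S : ℕ → Submodule K (Trees K E)) (hmono : Monotone S)
    (hleaf : ∀ e, leafTree K E e ∈ S 1)
    (hgraft : ∀ (j a b : ℕ), ∀ x ∈ arityFil K E a, ∀ y ∈ arityFil K E b, 1 ≤ a → 1 ≤ b → x ∈ S a →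
      y ∈ S b → graftMap j x y ∈ S (a + b)) (n : ℕ) : arityFil K E n ≤ S n := by
  refine iSup₂_le fun s hs => ?_
  refine le_trans ?_ (hmono hs)
  clear hs
  induction s with
  | leaf =>
    rintro _ ⟨x, rfl⟩
    exact hleaf (leafEquiv K E x)
  | node i l r hl hr =>
    rintro _ ⟨z, rfl⟩
    obtain ⟨w, rfl⟩ := (nodeEquiv K E i l r).symm.surjective z
    induction w with
    | zero => simp
    | add z w hz hw => rw [map_add, map_add]; exact add_mem hz hw
    | tmul x y =>
      change ofShape K E _ (graft i x y) ∈ S (l.leaves + r.leaves)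
      rw [← graftMap_ofShape]
      exact hgraft i _ _ (ofShape K E l x) (ofShape_mem_arityFil le_rfl x) (ofShape K E r y)
        (ofShape_mem_arityFil le_rfl y) l.leaves_pos r.leaves_pos (hl ⟨x, rfl⟩) (hr ⟨y, rfl⟩)

theorem graftMap_mem_arityFil {j m n : ℕ} {x y : Trees K E} (hx : x ∈ arityFil K E m)
    (hy : y ∈ arityFil K E n) : graftMap j x y ∈ arityFil K E (m + n) := by
  induction hx using Submodule.iSup_induction' with
  | zero => simp
  | add a b _ _ ha hb => rw [map_add, LinearMap.add_apply]; exact add_mem ha hb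
  | mem s x hx =>
    induction hy using Submodule.iSup_induction' with
    | zero => simp
    | add a b _ _ ha hb => rw [map_add]; exact add_mem ha hb
    | mem t y hy =>
      by_cases hs : s.leaves ≤ m
      · by_cases ht : t.leaves ≤ n
        · simp only [hs, ht, iSup_pos] at hx hy
          obtain ⟨x, rfl⟩ := hx
          obtain ⟨y, rfl⟩ := hy
          rw [graftMap_ofShape]
          exact ofShape_mem_arityFil (Nat.add_le_add hs ht) _
        · simp only [ht, not_false_eq_true, iSup_neg, Submodule.mem_bot] at hy
          simp [hy]
      · simp only [hs, not_false_eq_true, iSup_neg, Submodule.mem_bot] at hx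
        simp [hx]

/-- The contraction removes the right branch, which has at least one leaf, and it kills trees that
are a single leaf. This drop is what drives the inductions on the number of leaves. -/
theorem contractRight_mem_arityFil {i : ℕ} {g : Module.Dual K (Trees K E)}
    {R : Trees K E →ₗ[K] Trees K E} (hR : ∀ f x, f (R x) = treeMul i f g x) {n : ℕ} {x : Trees K E}
    (hx : x ∈ arityFil K E (n + 1)) : R x ∈ arityFil K E n := by
  refine arityFil_induction (fun n => (arityFil K E (n - 1)).comap R)
    (fun m n hmn => Submodule.comap_mono (arityFil_mono (Nat.sub_le_sub_right hmn 1)))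
    (fun e => ?_) (fun j a b x hx y _ _ hb _ _ => ?_) (n + 1) hx
  · have : R (leafTree K E e) = 0 := by
      rw [← Module.forall_dual_apply_eq_zero_iff K]
      exact fun f => by rw [hR, treeMul_leafTree]
    rw [Submodule.mem_comap, this]
    exact zero_mem _
  · have : R (graftMap j x y) = if j = i then g y • x else 0 := by
      rw [← sub_eq_zero, ← Module.forall_dual_apply_eq_zero_iff K]
      intro f
      rw [map_sub, hR, treeMul_graftMap]
      split_ifs <;> simp [mul_comm]
    rw [Submodule.mem_comap, this]
    split_ifs
    · exact Submodule.smul_mem _ _ (arityFil_mono (by omega) hx)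
    · exact zero_mem _

theorem contractLeft_mem_arityFil {i : ℕ} {f : Module.Dual K (Trees K E)}
    {L : Trees K E →ₗ[K] Trees K E} (hL : ∀ g x, g (L x) = treeMul i f g x) {n : ℕ} {x : Trees K E}
    (hx : x ∈ arityFil K E (n + 1)) : L x ∈ arityFil K E n := by
  refine arityFil_induction (fun n => (arityFil K E (n - 1)).comap L)
    (fun m n hmn => Submodule.comap_mono (arityFil_mono (Nat.sub_le_sub_right hmn 1)))
    (fun e => ?_) (fun j a b x _ y hy ha _ _ _ => ?_) (n + 1) hx
  · have : L (leafTree K E e) = 0 := by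
      rw [← Module.forall_dual_apply_eq_zero_iff K]
      exact fun f => by rw [hL, treeMul_leafTree]
    rw [Submodule.mem_comap, this]
    exact zero_mem _
  · have : L (graftMap j x y) = if j = i then f x • y else 0 := by
      rw [← sub_eq_zero, ← Module.forall_dual_apply_eq_zero_iff K]
      intro g
      rw [map_sub, hL, treeMul_graftMap]
      split_ifs <;> simp
    rw [Submodule.mem_comap, this]
    split_ifs
    · exact Submodule.smul_mem _ _ (arityFil_mono (by omega) hy)
    · exact zero_mem _

end Arity

/-! ### Coderivation-like maps are determined by their component in the cogenerators -/

section Uniqueness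

variable {K : Type v} [Field K] {E : Type u} [AddCommGroup E] [Module K E] {ℰ : ℤ → Submodule K E}
  {E' : Type u} [AddCommGroup E'] [Module K E'] {ℰ' : ℤ → Submodule K E'}

/-- The product evaluates `f` on a contraction of `x`, which stays in the coalgebra and has fewer
leaves. -/
theorem ceMul_apply_eq_zero_left {f g : CE ℰ} {n : ℕ}
    (hf : ∀ x : CECoalg ℰ, (x : Trees K E) ∈ arityFil K E n → f x = 0) (i : ℕ) {x : CECoalg ℰ}
    (hx : (x : Trees K E) ∈ arityFil K E (n + 1)) : ceMul ℰ i f g x = 0 := by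
  obtain ⟨R, hR⟩ := exists_contractRight i (g ∘ₗ ceProj ℰ)
  have hRx : R x ∈ CECoalg ℰ := fun φ hφ => by
    rw [hR]
    exact x.2 _ (RelIdeal.mulRight i _ _ hφ)
  change treeMul i (f ∘ₗ ceProj ℰ) (g ∘ₗ ceProj ℰ) (x : Trees K E) = 0
  rw [← hR, LinearMap.comp_apply, ceProj_apply ℰ ⟨R x, hRx⟩]
  exact hf _ (contractRight_mem_arityFil hR hx)

theorem ceMul_apply_eq_zero_right {f g : CE ℰ} {n : ℕ}
    (hg : ∀ x : CECoalg ℰ, (x : Trees K E) ∈ arityFil K E n → g x = 0) (i : ℕ) {x : CECoalg ℰ}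
    (hx : (x : Trees K E) ∈ arityFil K E (n + 1)) : ceMul ℰ i f g x = 0 := by
  obtain ⟨L, hL⟩ := exists_contractLeft i (f ∘ₗ ceProj ℰ)
  have hLx : L x ∈ CECoalg ℰ := fun φ hφ => by
    rw [hL]
    exact x.2 _ (RelIdeal.mulLeft i _ _ hφ)
  change treeMul i (f ∘ₗ ceProj ℰ) (g ∘ₗ ceProj ℰ) (x : Trees K E) = 0
  rw [← hL, LinearMap.comp_apply, ceProj_apply ℰ ⟨L x, hLx⟩]
  exact hg _ (contractLeft_mem_arityFil hL hx)

/-- A map to a space of trees is like a coderivation if the pullback of a product of homogeneous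
functionals is built from products that contain the pullback of a factor. -/
def CoderLike (ℰ' : ℤ → Submodule K E') (X : CECoalg ℰ →ₗ[K] Trees K E') : Prop :=
  ∀ (i : ℕ) (p q : ℤ) (f g : Module.Dual K (Trees K E')), TreeDegree ℰ' f p → TreeDegree ℰ' g q →
    ∀ x : CECoalg ℰ, (∀ a, ceMul ℰ i (f ∘ₗ X) a x = 0) → (∀ b, ceMul ℰ i b (g ∘ₗ X) x = 0) →
      treeMul i f g (X x) = 0

variable [DirectSum.Decomposition ℰ'] {X : CECoalg ℰ →ₗ[K] Trees K E'}

/-- Products of homogeneous functionals vanish on `X x`, since they involve `X` only on trees with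
fewer leaves, and a tree that they do not detect is a leaf. Inductive steps are thereby reduced to
computations in the underlying complex. -/
theorem CoderLike.eq_leafTree (hX : CoderLike ℰ' X) {n : ℕ}
    (h : ∀ x : CECoalg ℰ, (x : Trees K E) ∈ arityFil K E n → X x = 0) {x : CECoalg ℰ}
    (hx : (x : Trees K E) ∈ arityFil K E (n + 1)) :
    X x = leafTree K E' (leafPart K E' (X x)) :=
  eq_leafTree_of_homogeneous fun i p q f g hf hg => hX i p q f g hf hg x
    (fun _ => ceMul_apply_eq_zero_left
      (fun y hy => by rw [LinearMap.comp_apply, h y hy, map_zero]) i hx)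
    (fun _ => ceMul_apply_eq_zero_right
      (fun y hy => by rw [LinearMap.comp_apply, h y hy, map_zero]) i hx)

/-- A coderivation-like map is determined by its component in the cogenerators. -/
theorem CoderLike.eq_zero (hX : CoderLike ℰ' X) {n : ℕ}
    (h : ∀ x : CECoalg ℰ, (x : Trees K E) ∈ arityFil K E n → leafPart K E' (X x) = 0)
    {x : CECoalg ℰ} (hx : (x : Trees K E) ∈ arityFil K E n) : X x = 0 := by
  suffices H : ∀ m ≤ n, ∀ x : CECoalg ℰ, (x : Trees K E) ∈ arityFil K E m → X x = 0 from
    H n le_rfl x hx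
  intro m
  induction m with
  | zero =>
    intro _ x hx
    rw [arityFil_zero, Submodule.mem_bot] at hx
    rw [Subtype.ext (a1 := x) (a2 := 0) hx, map_zero]
  | succ m ih =>
    intro hm x hx
    rw [hX.eq_leafTree (ih (by omega)) hx, h x (arityFil_mono hm hx), map_zero]

theorem CoderLike.eq_zero_of_leafPart (hX : CoderLike ℰ' X) (h : ∀ x, leafPart K E' (X x) = 0) :
    X = 0 := by
  ext1 x
  obtain ⟨n, hn⟩ := exists_mem_arityFil (x : Trees K E)
  exact hX.eq_zero (fun x _ => h x) hn

end Uniqueness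

/-! ### Contraction of the underlying complex onto its cohomology -/

section Contraction

variable {K : Type v} [Field K] {E : Type u} [AddCommGroup E] [Module K E] {ℰ : ℤ → Submodule K E}

section Homotopy

variable (ℰ) [DirectSum.Decomposition ℰ]

/-- The projection onto the part of degree `n`. -/
def gradedProj (n : ℤ) : E →ₗ[K] E :=
  (ℰ n).subtype ∘ₗ DirectSum.component K ℤ (fun n => ℰ n) n ∘ₗ
    (DirectSum.decomposeLinearEquiv ℰ).toLinearMap

variable {ℰ}

theorem gradedProj_mem (n : ℤ) (e : E) : gradedProj ℰ n e ∈ ℰ n := Subtype.prop _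

theorem gradedProj_of_mem {m : ℤ} (n : ℤ) {e : E} (he : e ∈ ℰ m) :
    gradedProj ℰ n e = if m = n then e else 0 := by
  change (DirectSum.decompose ℰ e n : E) = _
  split_ifs with h
  · subst h
    exact DirectSum.decompose_of_mem_same ℰ he
  · exact DirectSum.decompose_of_mem_ne ℰ he h

/-- A differential of degree `1` on a graded vector space has a homotopy `h` of degree `-1` with
`d h d = d`, `h d h = h` and `h h = 0`. -/
theorem exists_homotopy {d : E →ₗ[K] E} (hd : ∀ n, ∀ e ∈ ℰ n, d e ∈ ℰ (n + 1))
    (hdd : ∀ e, d (d e) = 0) :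
    ∃ h : E →ₗ[K] E, (∀ n, ∀ e ∈ ℰ n, h e ∈ ℰ (n - 1)) ∧ (∀ e, d (h (d e)) = d e) ∧
      (∀ e, h (d (h e)) = h e) ∧ ∀ e, h (h e) = 0 := by
  -- A linear section of `d` over its image, extended to all of `E`, gives `d h d = d`, but without
  -- control of degrees.
  obtain ⟨g, hg⟩ := d.rangeRestrict.exists_rightInverse_of_surjective d.range_rangeRestrict
  obtain ⟨h₀, rfl⟩ := g.exists_extend
  have hh₀ (e : E) : d (h₀ (d e)) = d e :=
    congrArg Subtype.val (LinearMap.congr_fun hg (d.rangeRestrict e))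
  have hcomm (n : ℤ) (e : E) : d (gradedProj ℰ n e) = gradedProj ℰ (n + 1) (d e) := by
    induction e using DirectSum.Decomposition.inductionOn ℰ with
    | zero => simp
    | add a b ha hb => simp only [map_add, ha, hb]
    | @homogeneous m e =>
      rw [gradedProj_of_mem n e.2, gradedProj_of_mem (n + 1) (hd m e e.2), apply_ite d, map_zero]
      simp
  -- Only the component of degree `-1` is kept; as `d` is homogeneous, the identity `d h d = d`
  -- survives.
  obtain ⟨h₁, hh₁⟩ : ∃ h₁ : E →ₗ[K] E, ∀ n, ∀ e ∈ ℰ n, h₁ e = gradedProj ℰ (n - 1) (h₀ e) := by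
    refine ⟨DirectSum.toModule K ℤ _ (fun n => gradedProj ℰ (n - 1) ∘ₗ h₀ ∘ₗ (ℰ n).subtype) ∘ₗ
      (DirectSum.decomposeLinearEquiv ℰ).toLinearMap, fun n e he => ?_⟩
    rw [LinearMap.comp_apply, LinearEquiv.coe_coe,
      DirectSum.decomposeLinearEquiv_apply, DirectSum.decompose_of_mem ℰ he]
    erw [DirectSum.toModule_lof]
    rfl
  have hdeg₁ (n : ℤ) (e : E) (he : e ∈ ℰ n) : h₁ e ∈ ℰ (n - 1) :=
    hh₁ n e he ▸ gradedProj_mem _ _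
  have hd₁ (e : E) : d (h₁ (d e)) = d e := by
    induction e using DirectSum.Decomposition.inductionOn ℰ with
    | zero => simp
    | add a b ha hb => simp only [map_add, ha, hb]
    | @homogeneous n e =>
      rw [hh₁ _ _ (hd n e e.2), hcomm, hh₀, sub_add_cancel, gradedProj_of_mem _ (hd n e e.2),
        if_pos rfl]
  -- Passing to `h₁ d h₁` enforces `h d h = h`. The factor `1 - h₁ d` annihilates `h₁ d` from the
  -- left and so enforces `h h = 0`.
  refine ⟨h₁ ∘ₗ d ∘ₗ h₁ ∘ₗ (LinearMap.id - h₁ ∘ₗ d), fun n e he => ?_, fun e => ?_, fun e => ?_,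
    fun e => ?_⟩
  · have h1 : h₁ (d e) ∈ ℰ n := by simpa using hdeg₁ _ _ (hd n e he)
    have h2 := hdeg₁ _ _ (sub_mem he h1)
    have h3 := hdeg₁ _ _ (hd _ _ h2)
    simpa using h3
  all_goals simp [hdd, hd₁]

end Homotopy

theorem leafPart_mem {d : ℤ} {x : Trees K E} (hx : x ∈ treeGrading ℰ d) :
    leafPart K E x ∈ ℰ (1 - d) := by
  refine treeGrading_induction (ℰ := ℰ) (fun d => (ℰ (1 - d)).comap (leafPart K E))
    (fun n e he => ?_) (fun j p q x _ y _ _ _ => ?_) d hx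
  · rwa [Submodule.mem_comap, leafPart_leafTree, sub_sub_cancel]
  · rw [Submodule.mem_comap, leafPart_graftMap]
    exact zero_mem _

theorem leafIncl_mem {n : ℤ} {e : E} (he : e ∈ ℰ n) : leafIncl ℰ e ∈ ceGrading ℰ (1 - n) :=
  leafTree_mem_treeGrading he

theorem leafProj_mem {d : ℤ} {x : CECoalg ℰ} (hx : x ∈ ceGrading ℰ d) :
    leafProj ℰ x ∈ ℰ (1 - d) := leafPart_mem hx

@[simp]
theorem leafProj_leafIncl (e : E) : leafProj ℰ (leafIncl ℰ e) = e := leafPart_leafTree e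

theorem ceMul_leafIncl (i : ℕ) (f g : CE ℰ) (e : E) : ceMul ℰ i f g (leafIncl ℰ e) = 0 :=
  treeMul_leafTree _ _ _ e

theorem TreeDegree.restrict {f : Module.Dual K (Trees K E)} {p : ℤ} (hf : TreeDegree ℰ f p) :
    CEDegree ℰ (f ∘ₗ (CECoalg ℰ).subtype) p := fun d hd x hx => hf d hd x hx

namespace ELAlgebra

variable (A : ELAlgebra ℰ)

theorem unary_mem {n : ℤ} {e : E} (he : e ∈ ℰ n) : A.unary e ∈ ℰ (n + 1) := by
  have := leafProj_mem (A.map_degree _ _ (leafIncl_mem he))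
  rwa [show 1 - (1 - n - 1) = n + 1 by ring] at this

variable [DirectSum.Decomposition ℰ]

/-- The codifferential restricts to the unary product on the cogenerators. -/
theorem D_leafIncl (e : E) : A.D (leafIncl ℰ e) = leafIncl ℰ (A.unary e) := by
  refine Subtype.ext (eq_leafTree_of_homogeneous (ℰ := ℰ) fun i p q f g hf hg => ?_)
  rw [← Submodule.subtype_apply, ← LinearMap.comp_apply, ← ceMul_restrict]
  -- Every term of the deformed Leibniz rule is a product and hence vanishes on a leaf.
  refine (LinearMap.congr_fun (A.leibniz i p q _ _ hf.restrict hg.restrict) _).trans ?_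
  simp [Units.smul_def, ceMul_leafIncl]

theorem unary_unary (e : E) : A.unary (A.unary e) = 0 := by
  have := LinearMap.congr_fun A.sq_zero (leafIncl ℰ e)
  rw [LinearMap.comp_apply, D_leafIncl, D_leafIncl] at this
  simpa using congrArg (leafProj ℰ) this

omit [DirectSum.Decomposition ℰ] in
theorem cls_eq_zero {z : LinearMap.ker A.unary} (h : (z : E) ∈ LinearMap.range A.unary) :
    A.cls z = 0 :=
  (Submodule.Quotient.mk_eq_zero _).2 h

/-- A contraction of the underlying complex of an `EL_∞`-algebra onto its cohomology. -/
structure Contraction where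
  /-- The homotopy. -/
  h : E →ₗ[K] E
  /-- The choice of representatives. -/
  incl : A.Cohomology →ₗ[K] E
  /-- The projection onto cohomology. -/
  proj : E →ₗ[K] A.Cohomology
  h_mem : ∀ n, ∀ e ∈ ℰ n, h e ∈ ℰ (n - 1)
  incl_mem : ∀ n, ∀ x ∈ A.cohomologyGrading n, incl x ∈ ℰ n
  proj_mem : ∀ n, ∀ e ∈ ℰ n, proj e ∈ A.cohomologyGrading n
  proj_incl : ∀ x, proj (incl x) = x
  unary_incl : ∀ x, A.unary (incl x) = 0
  proj_unary : ∀ e, proj (A.unary e) = 0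
  h_incl : ∀ x, h (incl x) = 0
  proj_h : ∀ e, proj (h e) = 0
  h_h : ∀ e, h (h e) = 0
  homotopy : ∀ e, e = incl (proj e) + A.unary (h e) + h (A.unary e)
  proj_cocycle : ∀ z : LinearMap.ker A.unary, proj z = A.cls z

theorem exists_contraction : Nonempty A.Contraction := by
  obtain ⟨h, hdeg, hdhd, hhdh, hhh⟩ := exists_homotopy (fun n e he => A.unary_mem he) A.unary_unary
  -- By the side conditions on `h`, this is an idempotent chain map of degree 0 that kills
  -- coboundaries and the image of `h`. Its image consists of the harmonic representatives.
  let P : E →ₗ[K] E := LinearMap.id - A.unary ∘ₗ h - h ∘ₗ A.unary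
  have hP (e : E) : P e = e - A.unary (h e) - h (A.unary e) := rfl
  have hdP (e : E) : A.unary (P e) = 0 := by simp [hP, hdhd, unary_unary]
  have hPd (e : E) : P (A.unary e) = 0 := by simp [hP, hdhd, unary_unary]
  have hhP (e : E) : h (P e) = 0 := by simp [hP, hhdh, hhh]
  have hPh (e : E) : P (h e) = 0 := by simp [hP, hhdh, hhh]
  have hPP (e : E) : P (P e) = P e := by rw [hP (P e), hhP, hdP]; simp
  have hPmem (n : ℤ) (e : E) (he : e ∈ ℰ n) : P e ∈ ℰ n := by
    have h1 : A.unary (h e) ∈ ℰ n := by simpa using A.unary_mem (hdeg n e he)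
    have h2 : h (A.unary e) ∈ ℰ n := by simpa using hdeg _ _ (A.unary_mem he)
    exact sub_mem (sub_mem he h1) h2
  let proj : E →ₗ[K] A.Cohomology := A.cls ∘ₗ P.codRestrict _ hdP
  let incl : A.Cohomology →ₗ[K] E :=
    Submodule.liftQ _ (P ∘ₗ (LinearMap.ker A.unary).subtype) (by
      rintro ⟨_, _⟩ ⟨e, rfl⟩
      exact hPd e)
  have hincl (z : LinearMap.ker A.unary) : incl (A.cls z) = P z := rfl
  have hproj (e : E) : proj e = A.cls ⟨P e, hdP e⟩ := rfl
  have hsurj : Function.Surjective A.cls := Submodule.mkQ_surjective _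
  have hcocycle (z : LinearMap.ker A.unary) : proj z = A.cls z := by
    rw [hproj, ← sub_eq_zero, ← map_sub]
    refine A.cls_eq_zero ⟨-h z, ?_⟩
    change A.unary (-h z) = P z - z
    rw [hP, LinearMap.mem_ker.1 z.2, map_zero, map_neg]
    abel
  refine ⟨⟨h, incl, proj, hdeg, ?_, fun n e he => ?_, fun x => ?_, fun x => ?_, fun e => ?_,
    fun x => ?_, fun e => ?_, hhh, fun e => ?_, hcocycle⟩⟩
  · rintro n _ ⟨z, hz, rfl⟩
    exact hPmem n z hz
  · exact ⟨⟨P e, hdP e⟩, hPmem n e he, rfl⟩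
  · obtain ⟨z, rfl⟩ := hsurj x
    rw [hincl]
    refine Eq.trans ?_ (hcocycle z)
    rw [hproj, hproj]
    congr 2
    exact hPP _
  · obtain ⟨z, rfl⟩ := hsurj x
    exact hdP z
  · rw [hproj]
    exact A.cls_eq_zero ⟨0, by rw [map_zero]; exact (hPd e).symm⟩
  · obtain ⟨z, rfl⟩ := hsurj x
    exact hhP z
  · rw [hproj]
    exact A.cls_eq_zero ⟨0, by rw [map_zero]; exact (hPh e).symm⟩
  · rw [hproj, hincl]
    change e = P (P e) + _ + _
    rw [hPP, hP]
    abel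

variable {A}

omit [DirectSum.Decomposition ℰ] in
theorem Contraction.cls_incl (c : A.Contraction) (x : A.Cohomology) :
    A.cls ⟨c.incl x, c.unary_incl x⟩ = x :=
  (c.proj_cocycle _).symm.trans (c.proj_incl x)

/-- The decomposition of the cohomology into its homogeneous parts. -/
abbrev Contraction.decomposition (c : A.Contraction) :
    DirectSum.Decomposition A.cohomologyGrading :=
  DirectSum.Decomposition.ofLinearMap _
    (DirectSum.lmap (fun n => c.proj.restrict (p := ℰ n) (q := A.cohomologyGrading n)
      (c.proj_mem n)) ∘ₗ (DirectSum.decomposeLinearEquiv ℰ).toLinearMap ∘ₗ c.incl)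
    (by
      have h : DirectSum.coeLinearMap A.cohomologyGrading ∘ₗ
          DirectSum.lmap (fun n => c.proj.restrict (p := ℰ n) (q := A.cohomologyGrading n)
            (c.proj_mem n)) = c.proj ∘ₗ DirectSum.coeLinearMap ℰ :=
        DirectSum.linearMap_ext K fun n => LinearMap.ext fun e => by
          simp
      refine LinearMap.ext fun x => ?_
      refine (LinearMap.congr_fun h (DirectSum.decompose ℰ (c.incl x))).trans ?_
      have : DirectSum.coeLinearMap ℰ (DirectSum.decompose ℰ (c.incl x)) = c.incl x :=
        (DirectSum.decompose ℰ).symm_apply_apply _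
      rw [LinearMap.comp_apply, this, c.proj_incl]
      rfl)
    (by
      refine DirectSum.linearMap_ext K fun n => LinearMap.ext fun x => ?_
      simp only [LinearMap.comp_apply, DirectSum.coeLinearMap_lof, LinearEquiv.coe_coe,
        DirectSum.decomposeLinearEquiv_apply, LinearMap.id_apply]
      rw [DirectSum.decompose_of_mem ℰ (c.incl_mem n x x.2)]
      change DirectSum.lmap _ (DirectSum.lof K ℤ (fun n => ℰ n) n _) = _
      rw [DirectSum.lmap_lof]
      exact congrArg _ (Subtype.ext (c.proj_incl x)))

end ELAlgebra

end Contraction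

/-! ### Restriction of products and morphisms to the Chevalley-Eilenberg coalgebras -/

section CoalgebraMorphisms

variable {K : Type v} [Field K] {E : Type u} [AddCommGroup E] [Module K E] {ℰ : ℤ → Submodule K E}
  {E' : Type u} [AddCommGroup E'] [Module K E'] {ℰ' : ℤ → Submodule K E'}

theorem ceMul_coe (i : ℕ) (f g : Module.Dual K (Trees K E)) (x : CECoalg ℰ) :
    treeMul i f g (x : Trees K E) =
      ceMul ℰ i (f ∘ₗ (CECoalg ℰ).subtype) (g ∘ₗ (CECoalg ℰ).subtype) x :=
  (LinearMap.congr_fun (ceMul_restrict i f g) x).symm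

theorem exists_extension (f : CE ℰ) :
    ∃ g : Module.Dual K (Trees K E), g ∘ₗ (CECoalg ℰ).subtype = f :=
  ⟨f ∘ₗ ceProj ℰ, LinearMap.ext fun x => congrArg f (ceProj_apply ℰ x)⟩

theorem ceMul_comp_sub_left {E₁ : Type u} [AddCommGroup E₁] [Module K E₁]
    {ℰ₁ : ℤ → Submodule K E₁} (i : ℕ) (f : CE ℰ₁) (Y Z : CECoalg ℰ →ₗ[K] CECoalg ℰ₁) (a : CE ℰ)
    (x : CECoalg ℰ) :
    ceMul ℰ i (f ∘ₗ (Y - Z)) a x = ceMul ℰ i (f ∘ₗ Y) a x - ceMul ℰ i (f ∘ₗ Z) a x := by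
  rw [LinearMap.comp_sub, ← ceMulHom_apply, map_sub]
  rfl

theorem ceMul_comp_sub_right {E₁ : Type u} [AddCommGroup E₁] [Module K E₁]
    {ℰ₁ : ℤ → Submodule K E₁} (i : ℕ) (f : CE ℰ₁) (Y Z : CECoalg ℰ →ₗ[K] CECoalg ℰ₁) (a : CE ℰ)
    (x : CECoalg ℰ) :
    ceMul ℰ i a (f ∘ₗ (Y - Z)) x = ceMul ℰ i a (f ∘ₗ Y) x - ceMul ℰ i a (f ∘ₗ Z) x := by
  rw [LinearMap.comp_sub, ← ceMulHom_apply, map_sub]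
  rfl

theorem CoderLike.of_ceMul {X : CECoalg ℰ →ₗ[K] CECoalg ℰ'}
    (h : ∀ (i : ℕ) (p q : ℤ) (f g : CE ℰ'), CEDegree ℰ' f p → CEDegree ℰ' g q → ∀ x : CECoalg ℰ,
      (∀ a, ceMul ℰ i (f ∘ₗ X) a x = 0) → (∀ b, ceMul ℰ i b (g ∘ₗ X) x = 0) →
        ceMul ℰ' i f g (X x) = 0) :
    CoderLike ℰ' ((CECoalg ℰ').subtype ∘ₗ X) := fun i p q f g hf hg x h1 h2 =>
  (ceMul_coe i f g (X x)).trans (h i p q _ _ hf.restrict hg.restrict x h1 h2)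

theorem CEDegree.comp {f : CE ℰ'} {p k : ℤ} (hf : CEDegree ℰ' f p)
    {F : CECoalg ℰ →ₗ[K] CECoalg ℰ'} (hF : ∀ d, ∀ x ∈ ceGrading ℰ d, F x ∈ ceGrading ℰ' (d + k)) :
    CEDegree ℰ (f ∘ₗ F) (p - k) := fun d hd x hx =>
  hf (d + k) (fun h => hd (by rw [← h, add_sub_cancel_right])) _ (hF d x hx)

theorem CEDegree.comp_zero {f : CE ℰ'} {p : ℤ} (hf : CEDegree ℰ' f p)
    {F : CECoalg ℰ →ₗ[K] CECoalg ℰ'} (hF : ∀ d, ∀ x ∈ ceGrading ℰ d, F x ∈ ceGrading ℰ' d) :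
    CEDegree ℰ (f ∘ₗ F) p := fun d hd x hx => hf d hd _ (hF d x hx)

theorem CEDegree.comp_pred {f : CE ℰ'} {p : ℤ} (hf : CEDegree ℰ' f p)
    {F : CECoalg ℰ →ₗ[K] CECoalg ℰ'} (hF : ∀ d, ∀ x ∈ ceGrading ℰ d, F x ∈ ceGrading ℰ' (d - 1)) :
    CEDegree ℰ (f ∘ₗ F) (p + 1) := by
  have := hf.comp (k := -1) hF
  rwa [sub_neg_eq_add] at this

section CeMap

variable {a : E →ₗ[K] E'} {w : Trees K E' →ₗ[K] E'} (ha : ∀ n, ∀ e ∈ ℰ n, a e ∈ ℰ' n)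
  (hw : ∀ d, ∀ x ∈ treeGrading ℰ' d, w x ∈ ℰ' (1 - d))

/-- The restriction of `coalgMap` to the Chevalley-Eilenberg coalgebras. -/
def ceMap : CECoalg ℰ →ₗ[K] CECoalg ℰ' :=
  (coalgMap a w).restrict fun _ hx => coalgMap_mem_CECoalg ha hw hx

theorem ceMap_mem {d : ℤ} {x : CECoalg ℰ} (hx : x ∈ ceGrading ℰ d) :
    ceMap ha hw x ∈ ceGrading ℰ' d :=
  coalgMap_mem_treeGrading ha hw hx

theorem ceMul_comp_ceMap (i : ℕ) (f g : CE ℰ') :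
    ceMul ℰ' i f g ∘ₗ ceMap ha hw = ceMul ℰ i (f ∘ₗ ceMap ha hw) (g ∘ₗ ceMap ha hw) := by
  obtain ⟨f, rfl⟩ := exists_extension f
  obtain ⟨g, rfl⟩ := exists_extension g
  rw [ceMul_restrict]
  refine Eq.trans ?_ (ceMul_restrict i (f ∘ₗ coalgMap a w) (g ∘ₗ coalgMap a w)).symm
  rw [← treeMul_comp_coalgMap]
  rfl

theorem ceMul_ceMap (i : ℕ) (f g : CE ℰ') (x : CECoalg ℰ) :
    ceMul ℰ' i f g (ceMap ha hw x) = ceMul ℰ i (f ∘ₗ ceMap ha hw) (g ∘ₗ ceMap ha hw) x :=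
  LinearMap.congr_fun (ceMul_comp_ceMap ha hw i f g) x

theorem ceMap_leafIncl (e : E) : ceMap ha hw (leafIncl ℰ e) = leafIncl ℰ' (a e) :=
  Subtype.ext (coalgMap_leafTree a w e)

end CeMap

end CoalgebraMorphisms

/-! ### Homotopy transfer to the cohomology -/

namespace ELAlgebra.Contraction

variable {K : Type v} [Field K] {E : Type u} [AddCommGroup E] [Module K E] {ℰ : ℤ → Submodule K E}
  [DirectSum.Decomposition ℰ] {A : ELAlgebra ℰ} (c : A.Contraction)

/-- The recursion for the higher components of the inclusion of the minimal model. -/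
def perturbation : Trees K E →ₗ[K] E :=
  -(c.h ∘ₗ (leafProj ℰ ∘ₗ A.D ∘ₗ homProj ℰ - A.unary ∘ₗ leafPart K E))

theorem perturbation_mem (d : ℤ) (x : Trees K E) (hx : x ∈ treeGrading ℰ d) :
    c.perturbation x ∈ ℰ (1 - d) := by
  have h1 := leafProj_mem (A.map_degree _ _ (homProj_mem hx))
  have h2 := A.unary_mem (leafPart_mem hx)
  rw [show 1 - d + 1 = 1 - (d - 1) by ring] at h2
  have h3 := c.h_mem _ _ (sub_mem h1 h2)
  rw [show 1 - (d - 1) - 1 = 1 - d by ring] at h3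
  exact neg_mem h3

/-- On a leaf the codifferential is the unary product, which `perturbation` subtracts. This is the
condition under which the recursion for `psi` becomes an implicit equation. -/
theorem perturbation_leafTree (e : E) : c.perturbation (leafTree K E e) = 0 := by
  have : homProj ℰ (leafTree K E e) = leafIncl ℰ e := homProj_coe (leafIncl ℰ e)
  simp [perturbation, this, A.D_leafIncl]

/-- The inclusion of the minimal model. -/
def psi : CECoalg A.cohomologyGrading →ₗ[K] CECoalg ℰ := ceMap c.incl_mem c.perturbation_mem

/-- The morphism of coalgebras induced by the projection onto cohomology. -/
def rho : CECoalg ℰ →ₗ[K] CECoalg A.cohomologyGrading :=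
  ceMap (w := 0) c.proj_mem fun _ _ _ => zero_mem _

/-- This is the implicit equation of homotopy transfer; its recursive solution replaces the usual
sum over trees. -/
theorem leafProj_psi (x : CECoalg A.cohomologyGrading) :
    leafProj ℰ (c.psi x) = c.incl (leafProj _ x) -
      c.h (leafProj ℰ (A.D (c.psi x)) - A.unary (leafProj ℰ (c.psi x))) := by
  refine (leafPart_coalgMap c.perturbation_leafTree (x : Trees K A.Cohomology)).trans ?_
  rw [sub_eq_add_neg]
  congr 1
  change c.perturbation (c.psi x : Trees K E) = _
  simp [perturbation, leafProj]

omit [DirectSum.Decomposition ℰ] in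
theorem leafProj_rho (x : CECoalg ℰ) : leafProj _ (c.rho x) = c.proj (leafProj ℰ x) := by
  refine (leafPart_coalgMap (fun _ => rfl) (x : Trees K E)).trans ?_
  simp [leafProj]

theorem proj_leafProj_psi (x : CECoalg A.cohomologyGrading) :
    c.proj (leafProj ℰ (c.psi x)) = leafProj _ x := by
  rw [leafProj_psi, map_sub, c.proj_incl, c.proj_h, sub_zero]

theorem h_leafProj_psi (x : CECoalg A.cohomologyGrading) : c.h (leafProj ℰ (c.psi x)) = 0 := by
  rw [leafProj_psi, map_sub, c.h_incl, c.h_h, sub_zero]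

/-- Compare the implicit equation for `psi` with the homotopy identity for the same element, in
which the term with `h` of the element drops out. They differ by precisely this expression. -/
theorem h_leafProj_D_psi (x : CECoalg A.cohomologyGrading) :
    c.h (leafProj ℰ (A.D (c.psi x))) = 0 := by
  have h1 := c.leafProj_psi x
  have h2 := c.homotopy (leafProj ℰ (c.psi x))
  rw [c.proj_leafProj_psi, c.h_leafProj_psi, map_zero, add_zero] at h2
  rw [map_sub, sub_sub_eq_add_sub, ← h2, eq_sub_iff_add_eq, add_eq_left] at h1
  exact h1

variable [DirectSum.Decomposition A.cohomologyGrading]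

/-- The difference of two morphisms is coderivation-like, so the components in the cogenerators
decide. There `proj` kills the image of `h` and inverts `incl`. -/
theorem rho_psi : c.rho ∘ₗ c.psi = LinearMap.id := by
  have hX : CoderLike A.cohomologyGrading
      ((CECoalg A.cohomologyGrading).subtype ∘ₗ (c.rho ∘ₗ c.psi - LinearMap.id)) := by
    refine .of_ceMul fun i p q f g _ _ x h1 h2 => ?_
    simp only [ceMul_comp_sub_left, ceMul_comp_sub_right, sub_eq_zero, LinearMap.comp_id] at h1 h2
    rw [LinearMap.sub_apply, map_sub, sub_eq_zero, LinearMap.comp_apply, rho, psi, ceMul_ceMap,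
      ceMul_ceMap]
    exact (h1 _).trans (h2 _)
  have := hX.eq_zero_of_leafPart fun x => by
    change leafProj _ (c.rho (c.psi x) - x) = 0
    rw [map_sub, leafProj_rho, proj_leafProj_psi, sub_self]
  refine sub_eq_zero.1 (LinearMap.ext fun x => Subtype.ext (LinearMap.congr_fun this x))

theorem rho_psi_apply (x : CECoalg A.cohomologyGrading) : c.rho (c.psi x) = x :=
  LinearMap.congr_fun c.rho_psi x

omit [DirectSum.Decomposition A.cohomologyGrading] in
theorem psi_mem (d : ℤ) (x : CECoalg A.cohomologyGrading)
    (hx : x ∈ ceGrading A.cohomologyGrading d) : c.psi x ∈ ceGrading ℰ d :=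
  ceMap_mem _ _ hx

omit [DirectSum.Decomposition A.cohomologyGrading] in
omit [DirectSum.Decomposition ℰ] in
theorem rho_mem (d : ℤ) (x : CECoalg ℰ) (hx : x ∈ ceGrading ℰ d) :
    c.rho x ∈ ceGrading A.cohomologyGrading d :=
  ceMap_mem _ _ hx

omit [DirectSum.Decomposition A.cohomologyGrading] in
theorem ceMul_psi (i : ℕ) (f g : CE ℰ) (x : CECoalg A.cohomologyGrading) :
    ceMul ℰ i f g (c.psi x) = ceMul _ i (f ∘ₗ c.psi) (g ∘ₗ c.psi) x :=
  ceMul_ceMap _ _ i f g x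

omit [DirectSum.Decomposition A.cohomologyGrading] in
/-- The codifferential of the minimal model. -/
def transferD : CECoalg A.cohomologyGrading →ₗ[K] CECoalg A.cohomologyGrading :=
  c.rho ∘ₗ A.D ∘ₗ c.psi

/-- Pull functionals back along `rho`, apply the rule for `A.D` and restrict along `psi`.
Undifferentiated factors return unchanged because `rho ∘ psi` is the identity, so neither map has to
commute with the codifferentials yet. -/
theorem transferD_leibniz (i : ℕ) (p q : ℤ) (f g : CE A.cohomologyGrading)
    (hf : CEDegree A.cohomologyGrading f p) (hg : CEDegree A.cohomologyGrading g q) :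
    DeformedLeibniz (ceMul A.cohomologyGrading) (fun f => f ∘ₗ c.transferD) i p q f g := by
  refine LinearMap.ext fun x => ?_
  have h := LinearMap.congr_fun
    (A.leibniz i p q _ _ (hf.comp_zero c.rho_mem) (hg.comp_zero c.rho_mem)) (c.psi x)
  have hrho (i : ℕ) (f g : CE A.cohomologyGrading) :
      ceMul ℰ i (f ∘ₗ c.rho) (g ∘ₗ c.rho) = ceMul _ i f g ∘ₗ c.rho :=
    (ceMul_comp_ceMap _ _ i f g).symm
  have hD : c.rho ∘ₗ A.D ∘ₗ c.psi = c.transferD := rfl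
  simp only [LinearMap.add_apply, LinearMap.sub_apply, LinearMap.smul_apply, ceMul_psi,
    LinearMap.comp_assoc, rho_psi, LinearMap.comp_id, hD] at h
  rw [hrho] at h
  change (ceMul A.cohomologyGrading i f g ∘ₗ c.transferD) x = _
  simp only [LinearMap.add_apply, LinearMap.sub_apply, LinearMap.smul_apply]
  exact h

omit [DirectSum.Decomposition A.cohomologyGrading] in
theorem transferD_mem (d : ℤ) (x : CECoalg A.cohomologyGrading)
    (hx : x ∈ ceGrading A.cohomologyGrading d) :
    c.transferD x ∈ ceGrading A.cohomologyGrading (d - 1) :=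
  c.rho_mem _ _ (A.map_degree _ _ (c.psi_mem _ _ hx))

omit [DirectSum.Decomposition A.cohomologyGrading] in
theorem leafProj_transferD (x : CECoalg A.cohomologyGrading) :
    leafProj _ (c.transferD x) = c.proj (leafProj ℰ (A.D (c.psi x))) :=
  c.leafProj_rho _

omit [DirectSum.Decomposition A.cohomologyGrading] in
/-- The failure of `psi` to commute with the codifferentials. -/
def defect : CECoalg A.cohomologyGrading →ₗ[K] CECoalg ℰ :=
  A.D ∘ₗ c.psi - c.psi ∘ₗ c.transferD

omit [DirectSum.Decomposition A.cohomologyGrading] in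
theorem defect_apply (x : CECoalg A.cohomologyGrading) :
    c.defect x = A.D (c.psi x) - c.psi (c.transferD x) := rfl

/-- Both composites obey the deformed Leibniz rule along `psi` with the same correction terms, which
cancel in the difference. -/
theorem coderLike_defect : CoderLike ℰ ((CECoalg ℰ).subtype ∘ₗ c.defect) := by
  refine .of_ceMul fun i p q f g hf hg x h1 h2 => ?_
  have hA := LinearMap.congr_fun (A.leibniz i p q f g hf hg) (c.psi x)
  have hB := LinearMap.congr_fun (c.transferD_leibniz i p q _ _ (hf.comp_zero c.psi_mem)
    (hg.comp_zero c.psi_mem)) x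
  simp only [defect, ceMul_comp_sub_left, ceMul_comp_sub_right, sub_eq_zero] at h1 h2
  rw [defect_apply, map_sub, sub_eq_zero, ceMul_psi]
  simp only [LinearMap.add_apply, LinearMap.sub_apply, LinearMap.smul_apply, ceMul_psi,
    LinearMap.comp_assoc] at hA hB
  rw [h1, h2] at hA
  exact hA.trans hB.symm

theorem coderLike_transferD_sq : CoderLike A.cohomologyGrading
    ((CECoalg A.cohomologyGrading).subtype ∘ₗ (c.transferD ∘ₗ c.transferD)) := by
  refine .of_ceMul fun i p q f g hf hg x h1 h2 => ?_
  have hdeg (p : ℤ) (f : CE A.cohomologyGrading) (hf : CEDegree A.cohomologyGrading f p) :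
      CEDegree A.cohomologyGrading (compHom c.transferD f) (p + 1) := hf.comp_pred c.transferD_mem
  have h := LinearMap.congr_fun (deformedLeibniz_sq (m := ceMulHom (ℰ := A.cohomologyGrading))
    (Q := compHom c.transferD) (deg := fun p f => CEDegree A.cohomologyGrading f p) hdeg
    c.transferD_leibniz i hf hg) x
  refine h.trans ?_
  rw [LinearMap.add_apply]
  exact (congrArg₂ (· + ·) (h1 g) (h2 f)).trans (add_zero 0)

/-- Once the defect is a leaf, the homotopy identity reconstructs it from its images under `proj`,
`h` and `ε₁`. The first two vanish by the choice of `psi`, and `ε₁` of the defect is again, up to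
sign, a value of the defect, which `h` kills. -/
theorem defect_eq_zero : c.defect = 0 := by
  have hproj (x) : c.proj (leafProj ℰ (c.defect x)) = 0 := by
    rw [defect_apply, map_sub, map_sub, proj_leafProj_psi, leafProj_transferD, sub_self]
  have hh (x) : c.h (leafProj ℰ (c.defect x)) = 0 := by
    rw [defect_apply, map_sub, map_sub, h_leafProj_psi, h_leafProj_D_psi, sub_self]
  have hDD (z) : A.D (A.D z) = 0 := LinearMap.congr_fun A.sq_zero z
  suffices H : ∀ (n : ℕ) (x : CECoalg A.cohomologyGrading),
      (x : Trees K A.Cohomology) ∈ arityFil K A.Cohomology n → c.defect x = 0 by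
    refine LinearMap.ext fun x => ?_
    obtain ⟨n, hn⟩ := exists_mem_arityFil (x : Trees K A.Cohomology)
    exact H n x hn
  intro n
  induction n with
  | zero =>
    intro x hx
    rw [arityFil_zero, Submodule.mem_bot] at hx
    rw [Subtype.ext (a1 := x) (a2 := 0) hx, map_zero]
  | succ n ih =>
    have hleaf (x : CECoalg A.cohomologyGrading)
        (hx : (x : Trees K A.Cohomology) ∈ arityFil K A.Cohomology (n + 1)) :
        c.defect x = leafIncl ℰ (leafProj ℰ (c.defect x)) :=
      Subtype.ext (c.coderLike_defect.eq_leafTree (fun y hy => congrArg Subtype.val (ih y hy)) hx)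
    -- Here `transferD` is not yet known to square to zero. Up to the present number of leaves it
    -- does: the defect is a leaf, so it only contributes `proj ∘ ε₁ = 0`.
    have hsq (x : CECoalg A.cohomologyGrading)
        (hx : (x : Trees K A.Cohomology) ∈ arityFil K A.Cohomology (n + 1)) :
        c.transferD (c.transferD x) = 0 := by
      refine Subtype.ext (c.coderLike_transferD_sq.eq_zero (fun y hy => ?_) hx)
      change leafProj _ (c.transferD (c.transferD y)) = 0
      have h1 : c.psi (c.transferD y) = A.D (c.psi y) - c.defect y := by
        rw [defect_apply, sub_sub_cancel]
      rw [leafProj_transferD, h1, map_sub, hDD, hleaf y hy, A.D_leafIncl, zero_sub, map_neg,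
        leafProj_leafIncl, map_neg, c.proj_unary, neg_zero]
    intro x hx
    -- The mixed terms `D psi transferD` cancel, and the two squares vanish.
    have h1 : A.D (c.defect x) + c.defect (c.transferD x) = 0 := by
      rw [defect_apply, defect_apply, hsq x hx, map_sub, hDD, map_zero]
      abel
    have h2 : A.unary (leafProj ℰ (c.defect x)) = -leafProj ℰ (c.defect (c.transferD x)) := by
      rw [← leafProj_leafIncl (ℰ := ℰ) (A.unary _), ← A.D_leafIncl, ← hleaf x hx,
        eq_neg_of_add_eq_zero_left h1, map_neg]
    have h3 := c.homotopy (leafProj ℰ (c.defect x))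
    rw [hproj, hh, h2, map_neg, hh, map_zero, map_zero, neg_zero, add_zero, add_zero] at h3
    rw [hleaf x hx, h3, map_zero]

theorem D_psi (x : CECoalg A.cohomologyGrading) : A.D (c.psi x) = c.psi (c.transferD x) :=
  sub_eq_zero.1 (LinearMap.congr_fun c.defect_eq_zero x)

/-- The minimal model. -/
def minimalModel : ELAlgebra A.cohomologyGrading where
  D := c.transferD
  map_degree := c.transferD_mem
  leibniz := c.transferD_leibniz
  sq_zero := LinearMap.ext fun x => by
    change c.rho (A.D (c.psi (c.transferD x))) = 0
    rw [← c.D_psi, ← LinearMap.comp_apply A.D, A.sq_zero, LinearMap.zero_apply, map_zero]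

omit [DirectSum.Decomposition A.cohomologyGrading] in
theorem psi_leafIncl (x : A.Cohomology) : c.psi (leafIncl _ x) = leafIncl ℰ (c.incl x) :=
  ceMap_leafIncl _ _ x

theorem minimalModel_unary : c.minimalModel.unary = 0 := LinearMap.ext fun x => by
  change leafProj _ (c.transferD (leafIncl _ x)) = 0
  rw [leafProj_transferD, psi_leafIncl, A.D_leafIncl, leafProj_leafIncl, c.proj_unary]

/-- The morphism from the minimal model. -/
def fromMinimalModel : ELHom c.minimalModel A where
  F := c.psi
  map_degree := c.psi_mem
  map_mul := ceMul_comp_ceMap _ _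
  comm := LinearMap.ext fun x => (c.D_psi x).symm

theorem fromMinimalModel_linearPart (x : A.Cohomology) :
    c.fromMinimalModel.linearPart x = c.incl x := by
  change leafProj ℰ (c.psi (leafIncl _ x)) = _
  rw [psi_leafIncl, leafProj_leafIncl]

omit [DirectSum.Decomposition ℰ] [DirectSum.Decomposition A.cohomologyGrading] in
/-- If the unary product vanishes, then the cohomology is the underlying vector space. -/
theorem exists_cohomology_equiv {E : Type u} [AddCommGroup E] [Module K E]
    {ℰ : ℤ → Submodule K E} (B : ELAlgebra ℰ) (hB : B.unary = 0) :
    ∃ e : B.Cohomology ≃ₗ[K] E, ∀ z : LinearMap.ker B.unary, e (B.cls z) = z := by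
  have hker : LinearMap.ker B.unary = ⊤ := by rw [hB, LinearMap.ker_zero]
  have hrange : (LinearMap.range B.unary).submoduleOf (LinearMap.ker B.unary) = ⊥ := by
    rw [hB, LinearMap.range_zero]
    exact Submodule.ker_subtype _
  exact ⟨Submodule.quotEquivOfEqBot _ hrange ≪≫ₗ LinearEquiv.ofTop _ hker, fun z => rfl⟩

theorem fromMinimalModel_isQuasiIso : c.fromMinimalModel.IsQuasiIso := by
  obtain ⟨e, he⟩ := exists_cohomology_equiv c.minimalModel c.minimalModel_unary
  refine ⟨e, fun z => ⟨?_, ?_⟩⟩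
  · rw [fromMinimalModel_linearPart]
    exact c.unary_incl _
  · rw [he, ← c.cls_incl (z : A.Cohomology)]
    simp only [fromMinimalModel_linearPart, cls_incl]

end ELAlgebra.Contraction

/-! ### Counting leaves in a complement, and its inversion in characteristic 0 -/

section Counting

variable {K : Type v} [Field K]

section Polynomials

variable {V W : Type*} [AddCommGroup V] [Module K V] [AddCommGroup W] [Module K W]

open Polynomial

theorem aeval_intertwine {f : Module.End K V} {g : Module.End K W} {j : V →ₗ[K] W}
    (h : ∀ x, j (f x) = g (j x)) (q : K[X]) (x : V) : j (aeval f q x) = aeval g q (j x) := by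
  induction q using Polynomial.induction_on' with
  | add p q hp hq => simp only [map_add, LinearMap.add_apply, hp, hq]
  | monomial n a =>
    have (n : ℕ) : j ((f ^ n) x) = (g ^ n) (j x) := by
      induction n with
      | zero => rfl
      | succ n ih => rw [pow_succ', pow_succ', Module.End.mul_apply, Module.End.mul_apply, h, ih]
    simp [aeval_monomial, this]

theorem aeval_mem {f : Module.End K V} {S : Submodule K V} (h : ∀ x ∈ S, f x ∈ S) (q : K[X])
    {x : V} (hx : x ∈ S) : aeval f q x ∈ S := by
  have := aeval_intertwine (f := f.restrict h) (g := f) (j := S.subtype) (fun _ => rfl) q ⟨x, hx⟩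
  exact this ▸ Subtype.prop _

/-- Polynomials in maps that agree on `U` modulo `S ≤ U` agree on `U` modulo `S`. -/
theorem aeval_sub_aeval_mem {f g : Module.End K V} {S U : Submodule K V}
    (hU : ∀ x ∈ U, f x ∈ U) (hS : ∀ x ∈ S, g x ∈ S) (hfg : ∀ x ∈ U, f x - g x ∈ S) (q : K[X])
    {x : V} (hx : x ∈ U) : aeval f q x - aeval g q x ∈ S := by
  induction q using Polynomial.induction_on' with
  | add p q hp hq =>
    simp only [map_add, LinearMap.add_apply, add_sub_add_comm]
    exact add_mem hp hq
  | monomial n a =>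
    have (n : ℕ) : (f ^ n) x ∈ U ∧ (f ^ n) x - (g ^ n) x ∈ S := by
      induction n with
      | zero => exact ⟨hx, by simp⟩
      | succ n ih =>
        rw [pow_succ', pow_succ', Module.End.mul_apply, Module.End.mul_apply]
        refine ⟨hU _ ih.1, ?_⟩
        have := add_mem (hfg _ ih.1) (hS _ ih.2)
        rwa [map_sub, sub_add_sub_cancel] at this
    simp only [aeval_monomial, Module.End.mul_apply, Module.algebraMap_end_apply, ← smul_sub]
    exact S.smul_mem _ (this n).2

theorem aeval_apply_of_eq_smul {f : Module.End K V} {z : V} {k : K} (h : f z = k • z) (q : K[X]) :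
    aeval f q z = q.eval k • z := by
  induction q using Polynomial.induction_on' with
  | add p q hp hq => simp only [map_add, LinearMap.add_apply, eval_add, add_smul, hp, hq]
  | monomial n a =>
    have (n : ℕ) : (f ^ n) z = k ^ n • z := by
      induction n with
      | zero => simp
      | succ n ih =>
        rw [pow_succ', Module.End.mul_apply, ih, map_smul, h, smul_smul, pow_succ]
    simp [aeval_monomial, this, smul_smul, mul_comm]

/-- In characteristic 0 the numbers `1, …, m` are distinct and invertible in `K`, so Lagrange
interpolation applies to their inverses. -/
theorem exists_interpolation [CharZero K] (m : ℕ) :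
    ∃ q : K[X], ∀ k : ℕ, 1 ≤ k → k ≤ m → q.eval (k : K) * k = 1 := by
  refine ⟨Lagrange.interpolate (Finset.Icc 1 m) (fun k : ℕ => (k : K)) fun k => (k : K)⁻¹,
    fun k h1 h2 => ?_⟩
  rw [Lagrange.eval_interpolate_at_node _ (Nat.cast_injective.injOn) (Finset.mem_Icc.2 ⟨h1, h2⟩)]
  exact inv_mul_cancel₀ (Nat.cast_ne_zero.2 (by omega))

end Polynomials

variable {E : Type u} [AddCommGroup E] [Module K E]

/-- The even coderivation of the space of trees with components `u`. -/
def evenCoder (u : Trees K E →ₗ[K] E) : Trees K E →ₗ[K] Trees K E :=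
  coder (fun _ => 1) LinearMap.id u

theorem evenCoder_leafTree (u : Trees K E →ₗ[K] E) (e : E) :
    evenCoder u (leafTree K E e) = leafTree K E (u (leafTree K E e)) :=
  coder_leafTree ..

theorem evenCoder_graftMap (u : Trees K E →ₗ[K] E) (j : ℕ) (x y : Trees K E) :
    evenCoder u (graftMap j x y) = leafTree K E (u (graftMap j x y)) +
      (graftMap j (evenCoder u x) y + graftMap j x (evenCoder u y)) := by
  rw [evenCoder, coder_graftMap, one_smul, LinearMap.id_apply]

theorem treeMul_comp_evenCoder (u : Trees K E →ₗ[K] E) (i : ℕ) (f g : Module.Dual K (Trees K E)) :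
    treeMul i f g ∘ₗ evenCoder u =
      treeMul i (f ∘ₗ evenCoder u) g + treeMul i f (g ∘ₗ evenCoder u) := by
  rw [evenCoder, treeMul_comp_coder, one_smul, LinearMap.comp_id]

theorem evenCoder_mem_arityFil (u : Trees K E →ₗ[K] E) {n : ℕ} {x : Trees K E}
    (hx : x ∈ arityFil K E n) : evenCoder u x ∈ arityFil K E n := by
  refine arityFil_induction (fun n => (arityFil K E n).comap (evenCoder u))
    (fun m n hmn => Submodule.comap_mono (arityFil_mono hmn)) (fun e => ?_)
    (fun j a b x hx y hy ha _ hx' hy' => ?_) n hx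
  · rw [Submodule.mem_comap, evenCoder_leafTree]
    exact leafTree_mem_arityFil le_rfl _
  · rw [Submodule.mem_comap, evenCoder_graftMap]
    exact add_mem (leafTree_mem_arityFil (by omega) _)
      (add_mem (graftMap_mem_arityFil hx' hy) (graftMap_mem_arityFil hx hy'))

/-- Even coderivations with the same linear part agree up to terms with fewer leaves. -/
theorem evenCoder_sub_mem_arityFil {u v : Trees K E →ₗ[K] E}
    (huv : ∀ e, u (leafTree K E e) = v (leafTree K E e)) {n : ℕ} {x : Trees K E}
    (hx : x ∈ arityFil K E n) : evenCoder u x - evenCoder v x ∈ arityFil K E (n - 1) := by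
  refine arityFil_induction (fun n => (arityFil K E (n - 1)).comap (evenCoder u - evenCoder v))
    (fun m n hmn => Submodule.comap_mono (arityFil_mono (Nat.sub_le_sub_right hmn 1)))
    (fun e => ?_) (fun j a b x hx y hy ha hb hx' hy' => ?_) n hx
  · rw [Submodule.mem_comap, LinearMap.sub_apply, evenCoder_leafTree, evenCoder_leafTree, huv,
      sub_self]
    exact zero_mem _
  · rw [Submodule.mem_comap, LinearMap.sub_apply] at hx' hy' ⊢
    have h1 := graftMap_mem_arityFil (j := j) hx' hy
    have h2 := graftMap_mem_arityFil (j := j) hx hy'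
    rw [show a - 1 + b = a + b - 1 by omega] at h1
    rw [show a + (b - 1) = a + b - 1 by omega] at h2
    have h3 : leafTree K E (u (graftMap j x y) - v (graftMap j x y)) ∈ arityFil K E (a + b - 1) :=
      leafTree_mem_arityFil (by omega) _
    convert add_mem (add_mem h1 h2) h3 using 1
    rw [evenCoder_graftMap, evenCoder_graftMap]
    simp only [map_sub, LinearMap.sub_apply]
    abel

/-- The graded part of a morphism of coalgebras is determined by its linear component. -/
theorem coalgMap_comp_sub_mem_arityFil {H : Type u} [AddCommGroup H] [Module K H]
    (a : E →ₗ[K] H) (b : H →ₗ[K] E) (w : Trees K E →ₗ[K] E) {n : ℕ} {x : Trees K E}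
    (hx : x ∈ arityFil K E n) :
    coalgMap b w (coalgMap a 0 x) - coalgMap (b ∘ₗ a) 0 x ∈ arityFil K E (n - 1) := by
  -- The difference of two grafts telescopes into grafts of one difference with one image, so the
  -- bounds on both images have to be part of the induction.
  let S (n : ℕ) : Submodule K (Trees K E) :=
    (arityFil K E n).comap (coalgMap b w ∘ₗ coalgMap a 0) ⊓
      (arityFil K E n).comap (coalgMap (b ∘ₗ a) 0) ⊓
        (arityFil K E (n - 1)).comap (coalgMap b w ∘ₗ coalgMap a 0 - coalgMap (b ∘ₗ a) 0)
  suffices h : arityFil K E n ≤ S n from (h hx).2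
  refine arityFil_induction S (fun m n hmn => inf_le_inf (inf_le_inf
    (Submodule.comap_mono (arityFil_mono hmn)) (Submodule.comap_mono (arityFil_mono hmn)))
    (Submodule.comap_mono (arityFil_mono (Nat.sub_le_sub_right hmn 1)))) (fun e => ?_)
    (fun j m n x _ y _ hm hn hx hy => ?_) n
  · refine ⟨⟨?_, ?_⟩, ?_⟩
    · simpa using leafTree_mem_arityFil le_rfl _
    · simpa using leafTree_mem_arityFil le_rfl _
    · simp
  · obtain ⟨⟨hx1, hx2⟩, hx3⟩ := hx
    obtain ⟨⟨hy1, hy2⟩, hy3⟩ := hy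
    simp only [SetLike.mem_coe, Submodule.mem_comap, LinearMap.sub_apply,
      LinearMap.comp_apply] at hx1 hx2 hx3 hy1 hy2 hy3
    have h1 : coalgMap b w (coalgMap a 0 (graftMap j x y)) =
        graftMap j (coalgMap b w (coalgMap a 0 x)) (coalgMap b w (coalgMap a 0 y)) +
          leafTree K E (w (graftMap j (coalgMap b w (coalgMap a 0 x))
            (coalgMap b w (coalgMap a 0 y)))) := by
      simp [coalgMap_graftMap]
    have h2 : coalgMap (b ∘ₗ a) 0 (graftMap j x y) =
        graftMap j (coalgMap (b ∘ₗ a) 0 x) (coalgMap (b ∘ₗ a) 0 y) := by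
      simp [coalgMap_graftMap]
    refine ⟨⟨?_, ?_⟩, ?_⟩
    · rw [SetLike.mem_coe, Submodule.mem_comap, LinearMap.comp_apply, h1]
      exact add_mem (graftMap_mem_arityFil hx1 hy1) (leafTree_mem_arityFil (by omega) _)
    · rw [SetLike.mem_coe, Submodule.mem_comap, h2]
      exact graftMap_mem_arityFil hx2 hy2
    · rw [SetLike.mem_coe, Submodule.mem_comap, LinearMap.sub_apply, LinearMap.comp_apply, h1, h2]
      have h3 := graftMap_mem_arityFil (j := j) hx3 hy1
      have h4 := graftMap_mem_arityFil (j := j) hx2 hy3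
      rw [show m - 1 + n = m + n - 1 by omega] at h3
      rw [show m + (n - 1) = m + n - 1 by omega] at h4
      convert add_mem (add_mem h3 h4) (leafTree_mem_arityFil (n := m + n - 1) (by omega)
        (w (graftMap j (coalgMap b w (coalgMap a 0 x)) (coalgMap b w (coalgMap a 0 y))))) using 1
      simp only [map_sub, LinearMap.sub_apply]
      abel

open Polynomial in
/-- For a projection `P` of `E`, the operator that counts the leaves in the kernel of `P` is
invertible on the trees with at least one leaf in this kernel. -/
theorem exists_counting_inverse [CharZero K] {P : E →ₗ[K] E} (hP : ∀ e, P (P e) = P e)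
    (x : Trees K E) : ∃ q : K[X],
      aeval (evenCoder ((LinearMap.id - P) ∘ₗ leafPart K E)) (q * X) x = x - coalgMap P 0 x := by
  set N : Trees K E →ₗ[K] Trees K E := evenCoder ((LinearMap.id - P) ∘ₗ leafPart K E) with hN
  have hleaf (e : E) : N (leafTree K E e) = leafTree K E (e - P e) := by
    simp [hN, evenCoder_leafTree]
  have hgraft (j : ℕ) (x y : Trees K E) :
      N (graftMap j x y) = graftMap j (N x) y + graftMap j x (N y) := by
    simp [hN, evenCoder_graftMap]
  -- These are the eigenvectors of `N`, on which `coalgMap P 0` projects to the eigenvalue 0. A leaf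
  -- splits into a part with eigenvalue 0 and a part with eigenvalue 1, and eigenvalues add up under
  -- grafting.
  let W : Set (Trees K E) :=
    {z | ∃ k : ℕ, N z = (k : K) • z ∧ coalgMap P 0 z = if k = 0 then z else 0}
  have hspan : ∀ x : Trees K E, x ∈ Submodule.span K W := by
    refine tree_induction _ (fun e => ?_) fun j x y hx hy => ?_
    · rw [show e = P e + (e - P e) by abel, map_add]
      refine add_mem (Submodule.subset_span ⟨0, ?_, ?_⟩) (Submodule.subset_span ⟨1, ?_, ?_⟩) <;>
        simp [hleaf, hP]
    · induction hx using Submodule.span_induction with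
      | zero => simp
      | add a b _ _ ha hb => rw [map_add, LinearMap.add_apply]; exact add_mem ha hb
      | smul c a _ ha => rw [map_smul, LinearMap.smul_apply]; exact Submodule.smul_mem _ _ ha
      | mem x hx =>
        induction hy using Submodule.span_induction with
        | zero => simp
        | add a b _ _ ha hb => rw [map_add]; exact add_mem ha hb
        | smul c a _ ha => rw [map_smul]; exact Submodule.smul_mem _ _ ha
        | mem y hy =>
          obtain ⟨k, hk1, hk2⟩ := hx
          obtain ⟨l, hl1, hl2⟩ := hy
          refine Submodule.subset_span ⟨k + l, ?_, ?_⟩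
          · rw [hgraft, hk1, hl1, map_smul, map_smul, LinearMap.smul_apply, Nat.cast_add, add_smul]
          · have : coalgMap P 0 (graftMap j x y) =
                graftMap j (coalgMap P 0 x) (coalgMap P 0 y) := by simp [coalgMap_graftMap]
            rw [this, hk2, hl2]
            by_cases hk : k = 0 <;> by_cases hl : l = 0 <;> simp [hk, hl]
  -- A given tree involves finitely many eigenvalues, so a polynomial that inverts `1, …, m` for
  -- large `m` suffices.
  have key : ∃ m : ℕ, ∀ q : K[X], (∀ k : ℕ, 1 ≤ k → k ≤ m → q.eval (k : K) * k = 1) →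
      aeval N (q * X) x = x - coalgMap P 0 x := by
    induction hspan x using Submodule.span_induction with
    | zero => exact ⟨0, by simp⟩
    | add a b _ _ ha hb =>
      obtain ⟨m, hm⟩ := ha
      obtain ⟨n, hn⟩ := hb
      refine ⟨max m n, fun q hq => ?_⟩
      rw [map_add, map_add, hm q fun k h1 h2 => hq k h1 (h2.trans (le_max_left m n)),
        hn q fun k h1 h2 => hq k h1 (h2.trans (le_max_right m n))]
      abel
    | smul c a _ ha =>
      obtain ⟨m, hm⟩ := ha
      exact ⟨m, fun q hq => by rw [map_smul, map_smul, hm q hq, smul_sub]⟩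
    | mem z hz =>
      obtain ⟨k, hk1, hk2⟩ := hz
      refine ⟨k, fun q hq => ?_⟩
      rw [aeval_apply_of_eq_smul hk1, hk2, eval_mul, eval_X]
      by_cases hk : k = 0
      · simp [hk]
      · rw [hq k (by omega) le_rfl, if_neg hk, one_smul, sub_zero]
  obtain ⟨m, hm⟩ := key
  obtain ⟨q, hq⟩ := exists_interpolation (K := K) m
  exact ⟨q, hm q hq⟩

end Counting

/-! ### The Laplacian of the contraction -/

namespace ELAlgebra.Contraction

variable {K : Type v} [Field K] {E : Type u} [AddCommGroup E] [Module K E] {ℰ : ℤ → Submodule K E}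
  [DirectSum.Decomposition ℰ] {A : ELAlgebra ℰ} (c : A.Contraction)

omit [DirectSum.Decomposition ℰ] in
theorem h_leafPart_mem (d : ℤ) (x : Trees K E) (hx : x ∈ treeGrading ℰ d) :
    (c.h ∘ₗ leafPart K E) x ∈ ℰ (1 - (d + 1)) := by
  have := c.h_mem _ _ (leafPart_mem hx)
  rwa [sub_sub] at this

/-- The coderivation whose linear component is the homotopy. -/
def hCoder : CECoalg ℰ →ₗ[K] CECoalg ℰ :=
  (oddCoder ℰ (c.h ∘ₗ leafPart K E)).restrict fun _ hx =>
    oddCoder_mem_CECoalg c.h_leafPart_mem odd_one hx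

theorem hCoder_mem (d : ℤ) (x : CECoalg ℰ) (hx : x ∈ ceGrading ℰ d) :
    c.hCoder x ∈ ceGrading ℰ (d + 1) :=
  oddCoder_mem_treeGrading c.h_leafPart_mem hx

theorem leafProj_hCoder (x : CECoalg ℰ) : leafProj ℰ (c.hCoder x) = c.h (leafProj ℰ x) :=
  leafPart_coder _ _ _ (x : Trees K E)

theorem hCoder_leafIncl (e : E) : c.hCoder (leafIncl ℰ e) = leafIncl ℰ (c.h e) := by
  refine Subtype.ext ((coder_leafTree _ _ _ e).trans ?_)
  rw [LinearMap.comp_apply, leafPart_leafTree]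
  rfl

theorem exists_homogeneous_extension {f : CE ℰ} {p : ℤ} (hf : CEDegree ℰ f p) :
    ∃ g : Module.Dual K (Trees K E), TreeDegree ℰ g p ∧ g ∘ₗ (CECoalg ℰ).subtype = f :=
  ⟨f ∘ₗ homProj ℰ, fun d hd _ hx => hf d hd _ (homProj_mem hx),
    LinearMap.ext fun x => congrArg f (homProj_coe x)⟩

theorem ceMul_comp_hCoder (i : ℕ) (p q : ℤ) (f g : CE ℰ) (hf : CEDegree ℰ f p)
    (_ : CEDegree ℰ g q) :
    ceMul ℰ i f g ∘ₗ c.hCoder = Int.negOnePow i •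
      (ceMul ℰ i (f ∘ₗ c.hCoder) g + Int.negOnePow p • ceMul ℰ i f (g ∘ₗ c.hCoder)) := by
  obtain ⟨f, hf', rfl⟩ := exists_homogeneous_extension hf
  obtain ⟨g, rfl⟩ := exists_extension g
  refine LinearMap.ext fun x => ?_
  have h := LinearMap.congr_fun
    (treeMul_comp_oddCoder (u := c.h ∘ₗ leafPart K E) i hf' g) (x : Trees K E)
  simp only [LinearMap.smul_apply, LinearMap.add_apply, ceMul_coe] at h ⊢
  rw [LinearMap.comp_apply, ← ceMul_coe]
  exact h

/-- The anticommutator of the codifferential and the homotopy. -/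
def laplacian : CECoalg ℰ →ₗ[K] CECoalg ℰ := A.D ∘ₗ c.hCoder + c.hCoder ∘ₗ A.D

theorem laplacian_apply (x : CECoalg ℰ) :
    c.laplacian x = A.D (c.hCoder x) + c.hCoder (A.D x) := rfl

theorem laplacian_mem (d : ℤ) (x : CECoalg ℰ) (hx : x ∈ ceGrading ℰ d) :
    c.laplacian x ∈ ceGrading ℰ d := by
  have h1 := A.map_degree _ _ (c.hCoder_mem d x hx)
  have h2 := c.hCoder_mem _ _ (A.map_degree d x hx)
  rw [add_sub_cancel_right] at h1
  rw [sub_add_cancel] at h2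
  exact add_mem h1 h2

theorem laplacian_D (x : CECoalg ℰ) : c.laplacian (A.D x) = A.D (c.laplacian x) := by
  have hDD (z) : A.D (A.D z) = 0 := LinearMap.congr_fun A.sq_zero z
  simp [laplacian_apply, hDD]

theorem laplacian_leafIncl (e : E) :
    c.laplacian (leafIncl ℰ e) = leafIncl ℰ (e - c.incl (c.proj e)) := by
  rw [laplacian_apply, hCoder_leafIncl, A.D_leafIncl, A.D_leafIncl, hCoder_leafIncl, ← map_add]
  congr 1
  nth_rw 3 [c.homotopy e]
  abel

theorem ceMul_laplacian_of_homogeneous (i : ℕ) {p q : ℤ} {f g : CE ℰ} (hf : CEDegree ℰ f p)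
    (hg : CEDegree ℰ g q) (x : CECoalg ℰ) : ceMul ℰ i f g (c.laplacian x) =
      ceMul ℰ i (f ∘ₗ c.laplacian) g x + ceMul ℰ i f (g ∘ₗ c.laplacian) x := by
  have hdeg (p : ℤ) (f : CE ℰ) (hf : CEDegree ℰ f p) : CEDegree ℰ (compHom A.D f) (p + 1) :=
    hf.comp_pred A.map_degree
  have hdeg' (p : ℤ) (f : CE ℰ) (hf : CEDegree ℰ f p) : CEDegree ℰ (compHom c.hCoder f) (p - 1) :=
    hf.comp c.hCoder_mem
  have hL (f : CE ℰ) : f ∘ₗ c.laplacian = (f ∘ₗ A.D) ∘ₗ c.hCoder + (f ∘ₗ c.hCoder) ∘ₗ A.D :=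
    LinearMap.comp_add ..
  rw [hL, hL]
  refine Eq.trans ?_ (LinearMap.congr_fun (deformedLeibniz_anticommutator
    (m := ceMulHom (ℰ := ℰ)) (Q := compHom A.D) (R := compHom c.hCoder)
    (deg := fun p f => CEDegree ℰ f p) hdeg hdeg' A.leibniz c.ceMul_comp_hCoder i hf hg) x)
  exact map_add _ _ _

/-- An even coderivation of the space of trees that extends `laplacian`. -/
def treeLaplacian : Trees K E →ₗ[K] Trees K E :=
  evenCoder (leafProj ℰ ∘ₗ c.laplacian ∘ₗ homProj ℰ)

/-- Both sides obey the same co-Leibniz rule and have the same component in the cogenerators. The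
explicit model on trees gives control of the number of leaves and of inhomogeneous functionals. -/
theorem laplacian_coe (x : CECoalg ℰ) :
    (c.laplacian x : Trees K E) = c.treeLaplacian (x : Trees K E) := by
  let X : CECoalg ℰ →ₗ[K] Trees K E :=
    c.treeLaplacian ∘ₗ (CECoalg ℰ).subtype - (CECoalg ℰ).subtype ∘ₗ c.laplacian
  have hfX (f : Module.Dual K (Trees K E)) : f ∘ₗ X =
      (f ∘ₗ c.treeLaplacian) ∘ₗ (CECoalg ℰ).subtype -
        (f ∘ₗ (CECoalg ℰ).subtype) ∘ₗ c.laplacian := LinearMap.comp_sub ..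
  have hX : CoderLike ℰ X := by
    intro i p q f g hf hg x h1 h2
    have h3 := h1 (g ∘ₗ (CECoalg ℰ).subtype)
    have h4 := h2 (f ∘ₗ (CECoalg ℰ).subtype)
    rw [hfX, ← ceMulHom_apply, map_sub, AddMonoidHom.sub_apply, LinearMap.sub_apply,
      ceMulHom_apply, ceMulHom_apply, sub_eq_zero] at h3
    rw [hfX, ← ceMulHom_apply, map_sub, LinearMap.sub_apply, ceMulHom_apply, ceMulHom_apply,
      sub_eq_zero] at h4
    have h5 := c.ceMul_laplacian_of_homogeneous i hf.restrict hg.restrict x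
    have h6 : treeMul i f g (c.treeLaplacian x) = _ :=
      LinearMap.congr_fun (treeMul_comp_evenCoder _ i f g) (x : Trees K E)
    rw [LinearMap.add_apply, ceMul_coe, ceMul_coe] at h6
    change treeMul i f g (c.treeLaplacian x - c.laplacian x) = 0
    rw [map_sub, sub_eq_zero, h6, ceMul_coe, h5, ← h3, ← h4]
    rfl
  have h0 := hX.eq_zero_of_leafPart fun x => by
    change leafPart K E (c.treeLaplacian x - c.laplacian x) = 0
    rw [map_sub, treeLaplacian, evenCoder, leafPart_coder, sub_eq_zero]
    simp [leafProj]
  exact (sub_eq_zero.1 (LinearMap.congr_fun h0 x)).symm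

/-- A functional need not be a finite sum of homogeneous ones, so the homogeneous case does not
extend by additivity; the model on trees obeys the rule for all functionals. -/
theorem ceMul_laplacian (i : ℕ) (f g : CE ℰ) (x : CECoalg ℰ) :
    ceMul ℰ i f g (c.laplacian x) =
      ceMul ℰ i (f ∘ₗ c.laplacian) g x + ceMul ℰ i f (g ∘ₗ c.laplacian) x := by
  obtain ⟨f, rfl⟩ := exists_extension f
  obtain ⟨g, rfl⟩ := exists_extension g
  have h : treeMul i f g (c.treeLaplacian x) = _ :=
    LinearMap.congr_fun (treeMul_comp_evenCoder _ i f g) (x : Trees K E)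
  have hc (f : Module.Dual K (Trees K E)) : (f ∘ₗ (CECoalg ℰ).subtype) ∘ₗ c.laplacian =
      (f ∘ₗ c.treeLaplacian) ∘ₗ (CECoalg ℰ).subtype :=
    LinearMap.ext fun x => congrArg f (c.laplacian_coe x)
  rw [LinearMap.add_apply, ceMul_coe, ceMul_coe] at h
  rw [← ceMul_coe, laplacian_coe, h, hc, hc]
  rfl

variable [DirectSum.Decomposition A.cohomologyGrading]

-- The composite is coderivation-like, and its component in the cogenerators vanishes by
-- `h_leafProj_psi`.
omit [DirectSum.Decomposition A.cohomologyGrading] in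
theorem hCoder_psi (x : CECoalg A.cohomologyGrading) : c.hCoder (c.psi x) = 0 := by
  have hX : CoderLike ℰ ((CECoalg ℰ).subtype ∘ₗ (c.hCoder ∘ₗ c.psi)) := by
    refine .of_ceMul fun i p q f g hf hg x h1 h2 => ?_
    have h := LinearMap.congr_fun (c.ceMul_comp_hCoder i p q f g hf hg) (c.psi x)
    refine h.trans ?_
    simp only [LinearMap.smul_apply, LinearMap.add_apply, ceMul_psi, LinearMap.comp_assoc, h1, h2,
      smul_zero, add_zero]
  have h0 := hX.eq_zero_of_leafPart fun x => by
    change leafProj ℰ (c.hCoder (c.psi x)) = 0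
    rw [leafProj_hCoder, h_leafProj_psi]
  exact Subtype.ext (LinearMap.congr_fun h0 x)

theorem laplacian_psi (x : CECoalg A.cohomologyGrading) : c.laplacian (c.psi x) = 0 := by
  rw [laplacian_apply, hCoder_psi, map_zero, c.D_psi, hCoder_psi, add_zero]

/-! ### Splitting the coalgebra in characteristic 0 -/

section CharZero

variable [CharZero K]

open Polynomial

-- Modulo trees with fewer leaves, the Laplacian counts the leaves in the kernel of `incl ∘ proj`,
-- and `psi ∘ rho` applies `incl ∘ proj` to every leaf. So the inverse of the counting operator
-- carries over up to such terms.
omit [DirectSum.Decomposition A.cohomologyGrading] in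
theorem exists_approximation {n : ℕ} {x : CECoalg ℰ}
    (hx : (x : Trees K E) ∈ arityFil K E n) : ∃ q : K[X],
      ((x - c.psi (c.rho x) - aeval c.laplacian q (c.laplacian x) : CECoalg ℰ) : Trees K E) ∈
        arityFil K E (n - 1) := by
  have hP (e : E) : (c.incl ∘ₗ c.proj) ((c.incl ∘ₗ c.proj) e) = (c.incl ∘ₗ c.proj) e := by
    simp [c.proj_incl]
  obtain ⟨q, hq⟩ := exists_counting_inverse hP (x : Trees K E)
  refine ⟨q, ?_⟩
  have h1 : ((aeval c.laplacian q (c.laplacian x) : CECoalg ℰ) : Trees K E) =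
      aeval c.treeLaplacian (q * X) (x : Trees K E) := by
    refine (aeval_intertwine (f := c.laplacian) (g := c.treeLaplacian)
      (j := (CECoalg ℰ).subtype) c.laplacian_coe q (c.laplacian x)).trans ?_
    rw [Submodule.subtype_apply, laplacian_coe, map_mul, aeval_X]
    rfl
  have h2 := coalgMap_comp_sub_mem_arityFil c.proj c.incl c.perturbation hx
  have h3 := aeval_sub_aeval_mem (f := c.treeLaplacian)
    (g := evenCoder ((LinearMap.id - c.incl ∘ₗ c.proj) ∘ₗ leafPart K E))
    (fun x hx => evenCoder_mem_arityFil _ hx) (fun x hx => evenCoder_mem_arityFil _ hx)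
    (fun x hx => evenCoder_sub_mem_arityFil (fun e => ?_) hx) (q * X) hx
  · rw [Submodule.coe_sub, Submodule.coe_sub, h1]
    have h4 := neg_mem (add_mem h2 h3)
    rw [hq] at h4
    convert h4 using 1
    change _ - coalgMap c.incl c.perturbation (coalgMap c.proj 0 (x : Trees K E)) - _ = _
    abel
  · have : homProj ℰ (leafTree K E e) = leafIncl ℰ e := homProj_coe (leafIncl ℰ e)
    simp [this, laplacian_leafIncl]

omit [DirectSum.Decomposition A.cohomologyGrading] in
/-- The image of the minimal model and the image of the Laplacian span; this holds for each
invariant subspace. -/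
theorem exists_eq_psi_add_laplacian {S : Submodule K (CECoalg ℰ)}
    {T : Submodule K (CECoalg A.cohomologyGrading)} (hrho : ∀ x ∈ S, c.rho x ∈ T)
    (hpsi : ∀ y ∈ T, c.psi y ∈ S) (hL : ∀ x ∈ S, c.laplacian x ∈ S) {x : CECoalg ℰ} (hx : x ∈ S) :
    ∃ y ∈ T, ∃ z ∈ S, x = c.psi y + c.laplacian z := by
  obtain ⟨n, hn⟩ := exists_mem_arityFil (x : Trees K E)
  induction n generalizing x with
  | zero =>
    rw [arityFil_zero, Submodule.mem_bot] at hn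
    refine ⟨0, zero_mem _, 0, zero_mem _, ?_⟩
    rw [Subtype.ext (a1 := x) (a2 := 0) hn, map_zero, map_zero, add_zero]
  | succ n ih =>
    obtain ⟨q, hq⟩ := c.exists_approximation hn
    -- A polynomial in the Laplacian commutes with it, so the correction lies in its image.
    have hcomm : aeval c.laplacian q (c.laplacian x) = c.laplacian (aeval c.laplacian q x) :=
      (aeval_intertwine (j := c.laplacian) (fun _ => rfl) q x).symm
    have hqx : aeval c.laplacian q x ∈ S := aeval_mem hL q hx
    obtain ⟨y, hy, z, hz, h⟩ := ih (sub_mem (sub_mem hx (hpsi _ (hrho _ hx)))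
      (by rw [hcomm]; exact hL _ hqx)) hq
    refine ⟨c.rho x + y, add_mem (hrho _ hx) hy, aeval c.laplacian q x + z, add_mem hqx hz, ?_⟩
    rw [map_add, map_add, ← hcomm, add_add_add_comm, ← h]
    abel

/-- The remainder of the approximation has the same Laplacian as `x` but fewer leaves: `psi` maps
into the kernel, and the polynomial term is killed by the hypothesis. -/
theorem laplacian_eq_zero {x : CECoalg ℰ} (hx : c.laplacian (c.laplacian x) = 0) :
    c.laplacian x = 0 := by
  obtain ⟨n, hn⟩ := exists_mem_arityFil (x : Trees K E)
  induction n generalizing x with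
  | zero =>
    rw [arityFil_zero, Submodule.mem_bot] at hn
    rw [Subtype.ext (a1 := x) (a2 := 0) hn, map_zero]
  | succ n ih =>
    obtain ⟨q, hq⟩ := c.exists_approximation hn
    have hcomm : c.laplacian (aeval c.laplacian q (c.laplacian x)) = 0 := by
      rw [aeval_intertwine (j := c.laplacian) (fun _ => rfl) q, hx, map_zero]
    have h : c.laplacian (x - c.psi (c.rho x) - aeval c.laplacian q (c.laplacian x)) =
        c.laplacian x := by
      rw [map_sub, map_sub, laplacian_psi, hcomm, sub_zero, sub_zero]
    rw [← h]
    exact ih (by rw [h, hx]) hq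

theorem isCompl_psi_laplacian :
    IsCompl (LinearMap.range c.psi) (LinearMap.range c.laplacian) := by
  refine IsCompl.of_eq ?_ ?_
  · rw [eq_bot_iff]
    rintro _ ⟨⟨y, rfl⟩, ⟨z, hz⟩⟩
    rw [Submodule.mem_bot, ← hz]
    exact c.laplacian_eq_zero (by rw [hz, laplacian_psi])
  · rw [eq_top_iff]
    intro x _
    obtain ⟨y, -, z, -, rfl⟩ := c.exists_eq_psi_add_laplacian (S := ⊤) (T := ⊤)
      (fun _ _ => Submodule.mem_top) (fun _ _ => Submodule.mem_top) (fun _ _ => Submodule.mem_top)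
      (x := x) Submodule.mem_top
    exact Submodule.add_mem_sup ⟨y, rfl⟩ ⟨z, rfl⟩

/-- The projection to the minimal model along the image of the Laplacian. -/
def phi : CECoalg ℰ →ₗ[K] CECoalg A.cohomologyGrading :=
  LinearMap.ofIsCompl c.isCompl_psi_laplacian (c.rho ∘ₗ Submodule.subtype _) 0

theorem phi_psi (y : CECoalg A.cohomologyGrading) : c.phi (c.psi y) = y :=
  (LinearMap.ofIsCompl_apply_left c.isCompl_psi_laplacian ⟨c.psi y, y, rfl⟩).trans
    (c.rho_psi_apply y)

theorem phi_laplacian (z : CECoalg ℰ) : c.phi (c.laplacian z) = 0 :=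
  LinearMap.ofIsCompl_apply_right c.isCompl_psi_laplacian ⟨c.laplacian z, z, rfl⟩

omit [DirectSum.Decomposition A.cohomologyGrading] in
theorem phi_ext {M : Type*} [AddCommGroup M] [Module K M] {f g : CECoalg ℰ →ₗ[K] M}
    (h1 : ∀ y, f (c.psi y) = g (c.psi y)) (h2 : ∀ z, f (c.laplacian z) = g (c.laplacian z)) :
    f = g := by
  refine LinearMap.ext fun x => ?_
  obtain ⟨y, -, z, -, rfl⟩ := c.exists_eq_psi_add_laplacian (S := ⊤) (T := ⊤)
    (fun _ _ => Submodule.mem_top) (fun _ _ => Submodule.mem_top) (fun _ _ => Submodule.mem_top)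
    (x := x) Submodule.mem_top
  rw [map_add, map_add, h1, h2]

/-- The morphism to the minimal model. -/
def toMinimalModel : ELHom A c.minimalModel where
  F := c.phi
  map_degree d x hx := by
    -- The splitting is used inside the part of degree `d`, so that the component `y` is homogeneous
    -- as well.
    obtain ⟨y, hy, z, -, rfl⟩ := c.exists_eq_psi_add_laplacian (c.rho_mem d) (c.psi_mem d)
      (c.laplacian_mem d) hx
    rwa [map_add, phi_psi, phi_laplacian, add_zero]
  map_mul i f g := by
    have h1 (f : CE A.cohomologyGrading) : (f ∘ₗ c.phi) ∘ₗ c.psi = f :=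
      LinearMap.ext fun y => congrArg f (c.phi_psi y)
    have h2 (f : CE A.cohomologyGrading) : (f ∘ₗ c.phi) ∘ₗ c.laplacian = 0 :=
      LinearMap.ext fun z => (congrArg f (c.phi_laplacian z)).trans (map_zero f)
    refine c.phi_ext (fun y => ?_) fun z => ?_
    · rw [LinearMap.comp_apply, phi_psi, ceMul_psi, h1, h1]
    -- Both sides vanish on the image of the Laplacian: the right-hand side because the Laplacian
    -- can be moved to one of the factors, each of which it annihilates.
    · rw [LinearMap.comp_apply, phi_laplacian, map_zero, ceMul_laplacian, h2, h2,
        ← ceMulHom_apply, ← ceMulHom_apply, map_zero, map_zero]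
      simp
  comm := by
    refine c.phi_ext (fun y => ?_) fun z => ?_
    · rw [LinearMap.comp_apply, LinearMap.comp_apply, D_psi, phi_psi, phi_psi]
      rfl
    · rw [LinearMap.comp_apply, LinearMap.comp_apply, ← laplacian_D, phi_laplacian, phi_laplacian,
        map_zero]

theorem toMinimalModel_linearPart (e : E) : c.toMinimalModel.linearPart e = c.proj e := by
  change leafProj _ (c.phi (leafIncl ℰ e)) = _
  have h1 := c.laplacian_leafIncl e
  -- This is the splitting of a leaf into its harmonic part and the rest, on which the Laplacian
  -- acts as the identity.
  have h2 : leafIncl ℰ e = c.psi (leafIncl _ (c.proj e)) + c.laplacian (leafIncl ℰ e) := by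
    rw [h1, psi_leafIncl, ← map_add, add_sub_cancel]
  rw [h2, map_add, phi_psi, phi_laplacian, add_zero, leafProj_leafIncl]

theorem toMinimalModel_isQuasiIso : c.toMinimalModel.IsQuasiIso := by
  obtain ⟨e, he⟩ := exists_cohomology_equiv c.minimalModel c.minimalModel_unary
  refine ⟨e.symm, fun z => ?_⟩
  have h : c.toMinimalModel.linearPart z ∈ LinearMap.ker c.minimalModel.unary := by
    rw [minimalModel_unary, LinearMap.ker_zero]
    trivial
  refine ⟨h, e.symm_apply_eq.2 ?_⟩
  rw [he]
  exact ((c.toMinimalModel_linearPart z).trans (c.proj_cocycle z)).symm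

end CharZero

end ELAlgebra.Contraction

end ELInfinity

end

/-! ### The minimal model theorem -/

theorem mainTheorem6 {K : Type*} [Field K] {E : Type*} [AddCommGroup E] [Module K E]
    (ℰ : ℤ → Submodule K E) (hℰ : DirectSum.IsInternal ℰ) (A : ELInfinity.ELAlgebra ℰ) :
    DirectSum.IsInternal A.cohomologyGrading ∧
    ∃ B : ELInfinity.ELAlgebra A.cohomologyGrading,
      B.unary = 0 ∧
      (∃ ψ : ELInfinity.ELHom B A, ψ.IsQuasiIso ∧
        ∀ x : A.Cohomology, ∃ h : ψ.linearPart x ∈ LinearMap.ker A.unary,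
          A.cls ⟨ψ.linearPart x, h⟩ = x) ∧
      (CharZero K → ∃ φ : ELInfinity.ELHom A B, φ.IsQuasiIso ∧
        ∀ z : LinearMap.ker A.unary, φ.linearPart z = A.cls z) := by
  let _ : DirectSum.Decomposition ℰ := hℰ.chooseDecomposition
  obtain ⟨c⟩ := A.exists_contraction
  let _ : DirectSum.Decomposition A.cohomologyGrading := c.decomposition
  refine ⟨DirectSum.Decomposition.isInternal _, c.minimalModel, c.minimalModel_unary,
    ⟨c.fromMinimalModel, c.fromMinimalModel_isQuasiIso, fun x => ⟨?_, ?_⟩⟩, fun _ =>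
    ⟨c.toMinimalModel, c.toMinimalModel_isQuasiIso, fun z => ?_⟩⟩
  · rw [c.fromMinimalModel_linearPart]
    exact c.unary_incl x
  · simp only [c.fromMinimalModel_linearPart, c.cls_incl]
  · rw [c.toMinimalModel_linearPart, c.proj_cocycle]
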